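/- Let $k$ be a commutative ring containing $\mathbb{Q}$, let $A$ be a commutative $k$-algebra equipped with an augmentation, i.e. a $k$-algebra homomorphism $\varepsilon\colon A\to k$, with augmentation ideal $I=\ker\varepsilon$, and let $M$ be a symmetric $A$-bimodule (that is, an $A$-module) which is flat over $k$. Notation. For $B=A$ or $B=I$ let $C_\star(B,M)$ be the Hochschild complex $C_n(B,M)=M\otimes_k B^{\otimes n}$ with boundary $b=\sum_{i=0}^{n}(-1)^i\partial_i$, where $\partial_0(m\otimes b_1\otimes\cdots\otimes b_n)=mb_1\otimes b_2\otimes\cdots\otimes b_n$, $\partial_i$ multiplies $b_i$ and $b_{i+1}$ for $1\le i\le n-1$, and $\partial_n(m\otimes b_1\otimes\cdots\otimes b_n)=b_nm\otimes b_1\otimes\cdots\otimes b_{n-1}$. Put $C_\star(A)=C_\star(A,A)$. The group algebra $k[\Sigma_n]$ acts on $C_n(B,M)$ through the last $n$ tensor factors. For $n\geq 1$ the Eulerian idempotents $e_n^{(i)}\in\mathbb{Q}[\Sigma_n]$ are determined by $$\sum_{i} e_n^{(i)}X^i=\sum_{\sigma\in\Sigma_n}\operatorname{sgn}(\sigma)\binom{X+n-1-\operatorname{des}(\sigma)}{n}\,\sigma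 ,$$ where $\operatorname{des}(\sigma)$ is the number of descents of $\sigma$; in degree $0$ set $e_0^{(1)}=1$. Let $e_\star^{(1)}C_\star(I,M)\subseteq C_\star(I,M)$ be the subcomplex generated by the elements $e_n^{(1)}(m\otimes y_1\otimes\cdots\otimes y_n)$ with $m\in M$, $y_j\in I$ (the normalized Harrison complex). Let $sh_n=\sum_{i=1}^{n-1}sh_{i,n-i}\in k[\Sigma_n]$, where $sh_{i,n-i}$ is the signed sum of all $\sigma\in\Sigma_n$ which are increasing on $\{1,\dots,i\}$ and on $\{i+1,\dots,n\}$, let $Sh_\star(A)\subseteq C_\star(A)$ be the subcomplex generated by the elements $sh_n(a_0\otimes a_1\otimes\cdots\otimes a_n)$, and let the Harrison homology $Harr_\star(A,M)$ be the homology of the complex $M\otimes_A\bigl(C_\star(A)/Sh_\star(A)\bigr)$. Then for every $n\geq 0$ there is an isomorphism of $k$-modules $$H_n\bigl(e_\star^{(1)}C_\star(I,M)\bigr)\cong Harr_n(A,M).$$ -/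

import Mathlib

open scoped TensorProduct
open CategoryTheory

set_option linter.unusedSectionVars false

noncomputable section

namespace NormHarr

universe u v w x

/-! ### Shuffles and Eulerian idempotents in the group algebra of the symmetric group -/

section GroupAlgebra

/-- `σ` is an `i`-shuffle: it is increasing on the first `i` positions and increasing on the
remaining positions. -/
def IsShuffle {n : ℕ} (i : ℕ) (σ : Equiv.Perm (Fin n)) : Prop :=
  ∀ a b : Fin n, a < b → (b.val < i ∨ i ≤ a.val) → σ a < σ b

open Classical in
/-- `sh_{i,n-i} ∈ k[Σ_n]`, the signed sum of all `i`-shuffles. -/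
def shuffleElement (k : Type u) [CommRing k] (n i : ℕ) : MonoidAlgebra k (Equiv.Perm (Fin n)) :=
  ∑ σ : Equiv.Perm (Fin n) with IsShuffle i σ,
    MonoidAlgebra.single σ ((Equiv.Perm.sign σ : ℤ) : k)

/-- The total shuffle operator `sh_n = ∑_{i=1}^{n-1} sh_{i,n-i} ∈ k[Σ_n]`. -/
def totalShuffle (k : Type u) [CommRing k] (n : ℕ) : MonoidAlgebra k (Equiv.Perm (Fin n)) :=
  ∑ i ∈ Finset.Ico 1 n, shuffleElement k n i

/-- The number of descents of `σ`, i.e. of positions `a` with `σ a > σ (a + 1)`. -/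
def descents {n : ℕ} (σ : Equiv.Perm (Fin n)) : ℕ :=
  (Finset.univ.filter fun p : Fin n × Fin n => p.1.val + 1 = p.2.val ∧ σ p.2 < σ p.1).card

/-- The polynomial `binom(X + n - 1 - d, n) = (1 / n!) ∏_{j < n} (X + n - 1 - d - j)`. -/
def binomPoly (n d : ℕ) : Polynomial ℚ :=
  Polynomial.C ((n.factorial : ℚ)⁻¹) *
    ∏ j ∈ Finset.range n, (Polynomial.X + Polynomial.C ((n : ℚ) - 1 - d - j))

/-- The Eulerian idempotents `e_n^{(i)} ∈ ℚ[Σ_n]`. For `n ≥ 1` they are given by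
`∑_i e_n^{(i)} X^i = ∑_σ sgn(σ) binom(X + n - 1 - des σ, n) σ`. In degree `n = 0` the convention
is `e_0^{(1)} = 1` and `e_0^{(i)} = 0` for `i ≠ 1`, so that degree `0` belongs to the first summand
of a decomposition indexed by `i ≥ 1`. -/
def eulerianIdempotent : (n : ℕ) → (i : ℕ) → MonoidAlgebra ℚ (Equiv.Perm (Fin n))
  | 0, i => if i = 1 then 1 else 0
  | n + 1, i => ∑ σ : Equiv.Perm (Fin (n + 1)),
      MonoidAlgebra.single σ
        (((Equiv.Perm.sign σ : ℤ) : ℚ) * (binomPoly (n + 1) (descents σ)).coeff i)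

/-- The image of the Eulerian idempotent in `k[Σ_n]`, for `k` containing `ℚ`. -/
def eulerianElement (k : Type u) [CommRing k] [Algebra ℚ k] (n i : ℕ) :
    MonoidAlgebra k (Equiv.Perm (Fin n)) :=
  MonoidAlgebra.mapRingHom (Equiv.Perm (Fin n)) (algebraMap ℚ k) (eulerianIdempotent n i)

end GroupAlgebra

/-! ### The Hochschild complex

`B` is a commutative, possibly non-unital `k`-algebra, `M` a symmetric `B`-bimodule, the (left and
right) action of `B` on `M` being `φ`. An auxiliary `k`-algebra `R` acts on `M`, commuting
with `B`; it only records that everything is linear over `R` (one may think of `R = k`). -/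

section Hochschild

/-- The algebra part of the face `∂_i` on a tuple `(m, b_1, …, b_{n+1})`: drop the first entry if
`i = 0`, multiply the `i`-th and the `(i+1)`-st entry if `1 ≤ i ≤ n`, drop the last entry if
`i = n + 1`. -/
def faceTuple {B : Type v} [Mul B] {n : ℕ} (i : Fin (n + 2)) (b : Fin (n + 1) → B) :
    Fin n → B := fun j =>
  if j.val + 1 < i.val then b j.castSucc
  else if j.val + 1 = i.val then b j.castSucc * b j.succ
  else b j.succ

variable (k : Type u) [CommRing k]
variable (R : Type x) [CommRing R] [Algebra k R]
variable (B : Type v) [NonUnitalCommRing B] [Module k B] [IsScalarTower k B B] [SMulCommClass k B B]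
variable (M : Type w) [AddCommGroup M] [Module k M] [Module R M] [IsScalarTower k R M]
variable (φ : B →ₙₐ[k] Module.End R M)

/-- `C_n(B, M) = M ⊗ B^{⊗ n}`. -/
abbrev HC (n : ℕ) : Type (max u v w) := M ⊗[k] (⨂[k] _ : Fin n, B)

variable {k R B M}

/-- The module part of the face `∂_i` on a tuple `(m, b_1, …, b_{n+1})`: multiply `m` by `b_1` if
`i = 0`, by `b_{n+1}` if `i = n + 1`, and leave `m` unchanged otherwise. -/
def faceCoeff {n : ℕ} (i : Fin (n + 2)) (b : Fin (n + 1) → B) : Module.End R M :=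
  if i = 0 then φ (b 0) else if i = Fin.last (n + 1) then φ (b (Fin.last n)) else 1

/-- Given `b`, the map `m ↦ ∂_i (m ⊗ b_1 ⊗ ⋯ ⊗ b_{n+1})`. -/
def facePure {n : ℕ} (i : Fin (n + 2)) (b : Fin (n + 1) → B) : M →ₗ[R] HC k B M n :=
  ((TensorProduct.AlgebraTensorModule.mk k R M (⨂[k] _ : Fin n, B)).flip
    (PiTensorProduct.tprod k (faceTuple i b))).comp (faceCoeff φ i b)

lemma facePure_apply {n : ℕ} (i : Fin (n + 2)) (b : Fin (n + 1) → B) (m : M) :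
    facePure φ i b m = faceCoeff φ i b m ⊗ₜ[k] PiTensorProduct.tprod k (faceTuple i b) := rfl

lemma faceTuple_update {n : ℕ} (i : Fin (n + 2)) (b : Fin (n + 1) → B) (p : Fin (n + 1))
    (h₀ : ¬ (i = 0 ∧ p = 0)) (h₁ : ¬ (i = Fin.last (n + 1) ∧ p = Fin.last n)) :
    ∃ (q : Fin n) (f : B →ₗ[k] B), ∀ y,
      faceTuple i (Function.update b p y) = Function.update (faceTuple i b) q (f y) := by
  simp only [Fin.ext_iff, Fin.val_zero, Fin.val_last] at h₀ h₁
  by_cases hpi : p.val < i.val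
  · have hpn : p.val < n := by omega
    refine ⟨⟨p.val, hpn⟩, if p.val + 1 = i.val then LinearMap.mulRight k (b ⟨p.val + 1, by omega⟩)
      else LinearMap.id, fun y => ?_⟩
    ext j
    simp only [faceTuple, Function.update_apply, Fin.ext_iff, Fin.val_castSucc, Fin.val_succ]
    by_cases hj : j.val = p.val
    · have hs : b j.succ = b ⟨p.val + 1, by omega⟩ := congrArg b (Fin.ext (by simp [hj]))
      by_cases hi : p.val + 1 = i.val
      · have : ¬ j.val + 1 = p.val := by omega
        simp only [if_pos hi, if_pos hj, if_neg this, hs]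
        rw [if_neg (by omega), if_pos (by omega)]
        simp
      · have : p.val + 1 < i.val := by omega
        simp [hj, hi, this]
    · by_cases h2 : j.val + 1 < i.val
      · simp [hj, h2]
      · by_cases h3 : j.val + 1 = i.val
        · have : j.val + 1 ≠ p.val := by omega
          simp only [if_neg hj, if_neg h2, if_pos h3, if_neg this]
        · have : j.val + 1 ≠ p.val := by omega
          simp [hj, h2, h3, this]
  · have hp0 : 0 < p.val := by omega
    refine ⟨⟨p.val - 1, by omega⟩, if p.val = i.val then
      LinearMap.mulLeft k (b ⟨p.val - 1, by omega⟩) else LinearMap.id, fun y => ?_⟩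
    ext j
    simp only [faceTuple, Function.update_apply, Fin.ext_iff, Fin.val_castSucc, Fin.val_succ]
    by_cases hj : j.val + 1 = p.val
    · have hj' : j.val = p.val - 1 := by omega
      have hs : b j.castSucc = b ⟨p.val - 1, by omega⟩ := congrArg b (Fin.ext (by simp [hj']))
      have hne : p.val - 1 ≠ p.val := by omega
      have hnl : ¬ p.val < i.val := hpi
      by_cases hi : p.val = i.val
      · have : j.val ≠ p.val := by omega
        simp only [if_pos hi, if_pos hj', hj, hs, if_neg this, if_neg hnl]
        simp
      · simp only [if_neg hi, if_pos hj', hj, if_neg hnl]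
        simp
    · have hj' : ¬ j.val = p.val - 1 := by omega
      by_cases h2 : j.val + 1 < i.val
      · have : j.val ≠ p.val := by omega
        simp [hj', h2, this]
      · by_cases h3 : j.val + 1 = i.val
        · have : j.val ≠ p.val := by omega
          simp only [if_neg hj', if_neg h2, if_pos h3, if_neg this, if_neg hj]
        · simp [hj', h2, h3, hj]

/-- `facePure` is linear in every entry of `b`. -/
lemma facePure_update {n : ℕ} (i : Fin (n + 2)) (b : Fin (n + 1) → B) (p : Fin (n + 1)) :
    ∃ L : B →ₗ[k] (M →ₗ[R] HC k B M n), ∀ y, facePure φ i (Function.update b p y) = L y := by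
  have key : ∀ t : Fin n → B, ∃ L : B →ₗ[k] (M →ₗ[R] HC k B M n), ∀ y m,
      L y m = φ y m ⊗ₜ[k] PiTensorProduct.tprod k t := fun t =>
    ⟨{ toFun := fun y => ((TensorProduct.AlgebraTensorModule.mk k R M (⨂[k] _ : Fin n, B)).flip
          (PiTensorProduct.tprod k t)).comp (φ y)
       map_add' := fun y z => by ext m; simp [TensorProduct.add_tmul]
       map_smul' := fun c y => by ext m; simp [TensorProduct.smul_tmul'] }, fun y m => rfl⟩
  by_cases h₀ : i = 0 ∧ p = 0
  · obtain ⟨rfl, rfl⟩ := h₀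
    obtain ⟨L, hL⟩ := key (faceTuple 0 b)
    refine ⟨L, fun y => LinearMap.ext fun m => ?_⟩
    have : faceTuple 0 (Function.update b 0 y) = faceTuple 0 b := by
      ext j; simp [faceTuple]
    rw [hL, facePure_apply, this]
    simp [faceCoeff]
  by_cases h₁ : i = Fin.last (n + 1) ∧ p = Fin.last n
  · obtain ⟨rfl, rfl⟩ := h₁
    obtain ⟨L, hL⟩ := key (faceTuple (Fin.last (n + 1)) b)
    refine ⟨L, fun y => LinearMap.ext fun m => ?_⟩
    have : faceTuple (Fin.last (n + 1)) (Function.update b (Fin.last n) y)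
        = faceTuple (Fin.last (n + 1)) b := by
      ext j
      have : j.val ≠ n := by omega
      simp [faceTuple, Fin.ext_iff, this]
    rw [hL, facePure_apply, this]
    simp [faceCoeff]
  obtain ⟨q, f, hf⟩ := faceTuple_update (k := k) i b p h₀ h₁
  have hc : ∀ y, faceCoeff φ i (Function.update b p y) = faceCoeff φ i b := by
    intro y
    unfold faceCoeff
    by_cases h2 : i = 0
    · have : (0 : Fin (n + 1)) ≠ p := fun h => h₀ ⟨h2, h.symm⟩
      simp [h2, this]
    · by_cases h3 : i = Fin.last (n + 1)
      · have : Fin.last n ≠ p := fun h => h₁ ⟨h3, h.symm⟩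
        simp [h3, this]
      · simp [h2, h3]
  refine ⟨{ toFun := fun y => facePure φ i (Function.update b p y)
            map_add' := ?_
            map_smul' := ?_ }, fun y => rfl⟩
  · intro y z
    ext m
    simp only [facePure_apply, hc, hf, map_add, LinearMap.add_apply,
      MultilinearMap.map_update_add, TensorProduct.tmul_add]
  · intro c y
    ext m
    simp only [facePure_apply, hc, hf, map_smul, LinearMap.smul_apply, RingHom.id_apply,
      MultilinearMap.map_update_smul, TensorProduct.tmul_smul]

/-- `facePure` as a multilinear map. -/
def faceMultilinear {n : ℕ} (i : Fin (n + 2)) :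
    MultilinearMap k (fun _ : Fin (n + 1) => B) (M →ₗ[R] HC k B M n) :=
  MultilinearMap.mk' (facePure φ i)
    (fun b p x y => by
      obtain ⟨L, hL⟩ := facePure_update (k := k) φ i b p
      simp only [hL, map_add])
    (fun b p c x => by
      obtain ⟨L, hL⟩ := facePure_update (k := k) φ i b p
      simp only [hL, map_smul])

/-- The face map `∂_i : C_{n+1}(B, M) → C_n(B, M)`. -/
def face {n : ℕ} (i : Fin (n + 2)) : HC k B M (n + 1) →ₗ[R] HC k B M n :=
  TensorProduct.AlgebraTensorModule.lift (PiTensorProduct.lift (faceMultilinear φ i)).flip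

lemma face_tmul {n : ℕ} (i : Fin (n + 2)) (m : M) (b : Fin (n + 1) → B) :
    face φ i (m ⊗ₜ[k] PiTensorProduct.tprod k b)
      = faceCoeff φ i b m ⊗ₜ[k] PiTensorProduct.tprod k (faceTuple i b) := by
  simp only [face, TensorProduct.AlgebraTensorModule.lift_tmul, LinearMap.flip_apply,
    PiTensorProduct.lift.tprod]
  rfl

lemma HC_ext {P : Type*} [AddCommGroup P] [Module R P] {n : ℕ} {f g : HC k B M n →ₗ[R] P}
    (h : ∀ (m : M) (b : Fin n → B), f (m ⊗ₜ[k] PiTensorProduct.tprod k b)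
      = g (m ⊗ₜ[k] PiTensorProduct.tprod k b)) : f = g := by
  refine LinearMap.ext fun z => ?_
  induction z using TensorProduct.induction_on with
  | zero => simp
  | add a b ha hb => simp only [map_add, ha, hb]
  | tmul m t =>
    induction t using PiTensorProduct.induction_on with
    | smul_tprod r b =>
      have e : m ⊗ₜ[k] (r • PiTensorProduct.tprod k b)
          = (r • m) ⊗ₜ[k] PiTensorProduct.tprod k b := by
        rw [TensorProduct.tmul_smul, TensorProduct.smul_tmul']
      rw [e, h]
    | add a b ha hb => simp only [TensorProduct.tmul_add, map_add, ha, hb]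

lemma faceTuple_faceTuple {n : ℕ} (i j : Fin (n + 2)) (h : i ≤ j) (b : Fin (n + 2) → B) :
    faceTuple i (faceTuple j.succ b) = faceTuple j (faceTuple i.castSucc b) := by
  obtain ⟨g, rfl⟩ : ∃ g : ℕ → B, b = fun a => g a.val :=
    ⟨fun a => if h : a < n + 2 then b ⟨a, h⟩ else 0, by ext a; simp⟩
  have h' : i.val ≤ j.val := h
  ext a
  simp only [faceTuple, Fin.val_castSucc, Fin.val_succ]
  split_ifs <;> first | omega | rfl | rw [mul_assoc]

lemma faceCoeff_faceTuple {n : ℕ} (i j : Fin (n + 2)) (h : i ≤ j) (b : Fin (n + 2) → B) (m : M) :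
    faceCoeff φ i (faceTuple j.succ b) (faceCoeff φ j.succ b m)
      = faceCoeff φ j (faceTuple i.castSucc b) (faceCoeff φ i.castSucc b m) := by
  have h' : i.val ≤ j.val := h
  have comm : ∀ x y : B, φ x (φ y m) = φ y (φ x m) := fun x y => by
    have := congrArg (fun f : Module.End R M => f m) ((map_mul φ x y).symm.trans
      ((congrArg φ (mul_comm x y)).trans (map_mul φ y x)))
    simpa using this
  have hmul : ∀ x y : B, φ (x * y) m = φ x (φ y m) := fun x y => by
    rw [map_mul]; rfl
  obtain ⟨g, rfl⟩ : ∃ g : ℕ → B, b = fun a => g a.val :=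
    ⟨fun a => if h : a < n + 2 then b ⟨a, h⟩ else 0, by ext a; simp⟩
  have hj := j.isLt
  simp only [faceCoeff, faceTuple, Fin.ext_iff, Fin.val_castSucc, Fin.val_succ, Fin.val_zero,
    Fin.val_last]
  have hil : i.val ≠ n + 1 + 1 := by omega
  by_cases hi0 : i.val = 0
  · by_cases hj0 : j.val = 0
    · simp [hi0, hj0, comm]
    · by_cases hjl : j.val = n + 1
      · simp [hi0, hjl, comm (g 0)]
      · simp [hi0, hj0, hjl, Nat.pos_of_ne_zero hj0]
  · by_cases hjl : j.val = n + 1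
    · by_cases hi1 : i.val = n + 1
      · simp [hi1, hjl, comm (g n)]
      · have h1 : ¬ n + 1 < i.val := by omega
        have h2 : n + 1 ≠ i.val := by omega
        simp [hi0, hi1, hil, hjl, h1, h2]
    · have hi1 : i.val ≠ n + 1 := by omega
      have hj0 : j.val ≠ 0 := by omega
      simp [hi0, hi1, hil, hj0, hjl]

lemma face_face {n : ℕ} (i j : Fin (n + 2)) (h : i ≤ j) :
    (face φ i).comp (face φ j.succ) = (face φ j).comp (face φ (n := n + 1) i.castSucc) := by
  refine HC_ext fun m b => ?_
  simp only [LinearMap.comp_apply, face_tmul, faceTuple_faceTuple i j h,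
    faceCoeff_faceTuple φ i j h]

/-- The Hochschild boundary `b = ∑_i (-1)^i ∂_i : C_{n+1}(B, M) → C_n(B, M)`. -/
def hochD (n : ℕ) : HC k B M (n + 1) →ₗ[R] HC k B M n :=
  ∑ i : Fin (n + 2), (-1 : ℤ) ^ (i : ℕ) • face φ i

theorem hochD_hochD (n : ℕ) (z : HC k B M (n + 2)) : hochD φ n (hochD φ (n + 1) z) = 0 := by
  simp only [hochD, LinearMap.sum_apply, LinearMap.smul_apply, map_sum, map_zsmul,
    Finset.smul_sum, ← Finset.sum_product']
  let P := Fin (n + 3) × Fin (n + 2)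
  let S : Finset P := {ij : P | (ij.1 : ℕ) ≤ (ij.2 : ℕ)}
  rw [Finset.univ_product_univ, ← Finset.sum_add_sum_compl S, ← eq_neg_iff_add_eq_zero,
    ← Finset.sum_neg_distrib]
  refine Finset.sum_bij (fun (ij : P) hij => (ij.2.succ, Fin.castLT ij.1
    (lt_of_le_of_lt (Finset.mem_filter.mp hij).right (Fin.is_lt ij.2)))) ?_ ?_ ?_ ?_
  · intro ij hij
    simp_rw [S, Finset.compl_filter, Finset.mem_filter_univ, Fin.val_succ,
      Fin.val_castLT] at hij ⊢
    omega
  · rintro ⟨i, j⟩ hij ⟨i', j'⟩ hij' h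
    have h1 := congrArg (fun q => q.1.val) h
    have h2 := congrArg (fun q => q.2.val) h
    simp only [Fin.val_succ, Fin.val_castLT] at h1 h2
    exact Prod.ext (Fin.ext h2) (Fin.ext (by simpa using h1))
  · rintro ⟨i', j'⟩ hij'
    simp_rw [S, Finset.compl_filter, Finset.mem_filter_univ, not_le] at hij'
    refine ⟨(j'.castSucc, ⟨i'.val - 1, by omega⟩), ?_, ?_⟩
    · simp only [S, Finset.mem_filter_univ, Fin.val_castSucc]
      omega
    · refine Prod.ext (Fin.ext ?_) (Fin.ext ?_)
      · simp only [Fin.val_succ]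
        omega
      · simp only [Fin.val_castLT, Fin.val_castSucc]
  · rintro ⟨i, j⟩ hij
    simp only [S, Finset.mem_filter_univ] at hij
    have e := congrArg (fun f => f z) (face_face φ (Fin.castLT i (lt_of_le_of_lt hij j.isLt)) j hij)
    simp only [LinearMap.comp_apply, Fin.castSucc_castLT] at e
    dsimp only
    rw [smul_smul, smul_smul, ← neg_smul, ← e]
    congr 1
    simp only [Fin.val_succ, Fin.val_castLT]
    ring

/-! ### The action of the symmetric groups -/

variable (k B) in
/-- The left action of `Σ_n` on `B^{⊗ n}`:
`σ (b_1 ⊗ ⋯ ⊗ b_n) = b_{σ⁻¹(1)} ⊗ ⋯ ⊗ b_{σ⁻¹(n)}`. -/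
def permAction (n : ℕ) : Equiv.Perm (Fin n) →* Module.End k (⨂[k] _ : Fin n, B) where
  toFun σ := (PiTensorProduct.reindex k (fun _ : Fin n => B) σ).toLinearMap
  map_one' := by
    refine PiTensorProduct.ext (MultilinearMap.ext fun b => ?_)
    simp only [LinearMap.compMultilinearMap_apply, LinearEquiv.coe_coe]
    erw [PiTensorProduct.reindex_tprod]
    rfl
  map_mul' σ τ := by
    refine PiTensorProduct.ext (MultilinearMap.ext fun b => ?_)
    simp only [LinearMap.compMultilinearMap_apply, Module.End.mul_apply, LinearEquiv.coe_coe]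
    erw [PiTensorProduct.reindex_tprod, PiTensorProduct.reindex_tprod,
      PiTensorProduct.reindex_tprod]
    rfl

variable (k R B M) in
/-- The action `1_M ⊗ x` of `x ∈ k[Σ_n]` on `C_n(B, M) = M ⊗ B^{⊗ n}`. -/
def groupAlgebraAction {n : ℕ} (x : MonoidAlgebra k (Equiv.Perm (Fin n))) :
    HC k B M n →ₗ[R] HC k B M n :=
  TensorProduct.AlgebraTensorModule.lTensor R M
    (MonoidAlgebra.lift k (Module.End k (⨂[k] _ : Fin n, B)) (Equiv.Perm (Fin n))
      (permAction k B n) x)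

/-! ### Subcomplexes -/

/-- Degree `n` of the subcomplex of the Hochschild complex generated by a family `S` of
submodules `S n ⊆ C_n(B, M)`, i.e. of the smallest subcomplex containing `S`. If the boundary
maps `S (n + 1)` into `S n` for all `n`, this is `S n` itself. -/
def generated (S : ∀ n, Submodule R (HC k B M n)) (n : ℕ) : Submodule R (HC k B M n) :=
  S n ⊔ (S (n + 1)).map (hochD φ n)

lemma hochD_mem_generated (S : ∀ n, Submodule R (HC k B M n)) (n : ℕ) (z : HC k B M (n + 1))
    (hz : z ∈ generated φ S (n + 1)) : hochD φ n z ∈ generated φ S n := by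
  obtain ⟨a, ha, b, hb, rfl⟩ := Submodule.mem_sup.mp hz
  obtain ⟨c, -, rfl⟩ := hb
  rw [map_add, hochD_hochD, add_zero]
  exact Submodule.mem_sup_right ⟨a, ha, rfl⟩

/-- `generated φ S` is the family `S` itself whenever `S` is stable under the boundary. -/
lemma generated_eq (S : ∀ n, Submodule R (HC k B M n))
    (hS : ∀ n, ∀ z ∈ S (n + 1), hochD φ n z ∈ S n) (n : ℕ) : generated φ S n = S n :=
  sup_eq_left.mpr (Submodule.map_le_iff_le_comap.mpr (hS n))

/-- The chain complex of `R`-modules given by the subcomplex generated by `S`. -/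
def generatedComplex (S : ∀ n, Submodule R (HC k B M n)) :
    ChainComplex (ModuleCat.{max u v w} R) ℕ :=
  ChainComplex.of (fun n => ModuleCat.of R (generated φ S n))
    (fun n => ModuleCat.ofHom ((hochD φ n).restrict (hochD_mem_generated φ S n)))
    (fun n => by
      refine ModuleCat.hom_ext (LinearMap.ext fun z => ?_)
      exact Subtype.ext (hochD_hochD φ n z.1))

/-- For `k ⊇ ℚ`, the complex `e_⋆^{(i)} C_⋆(B, M)`: the subcomplex of the Hochschild complex
generated by the elements `e_n^{(i)} (m ⊗ b_1 ⊗ ⋯ ⊗ b_n)`. -/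
def eulerianComplex [Algebra ℚ k] (i : ℕ) : ChainComplex (ModuleCat.{max u v w} R) ℕ :=
  generatedComplex φ fun n =>
    LinearMap.range (groupAlgebraAction k R B M (eulerianElement k n i))

end Hochschild

/-! ### The Harrison complex of a commutative algebra -/

section Harrison

variable (k : Type u) [CommRing k] (A : Type v) [CommRing A] [Algebra k A]

/-- The action of `A` on itself by multiplication. -/
def selfAction : A →ₙₐ[k] Module.End A A := (Algebra.lsmul k A A : A →ₐ[k] Module.End A A)

/-- Degree `n` of the shuffle complex `Sh_⋆(A)`, the subcomplex of `C_⋆(A) = C_⋆(A, A)` generated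
by the elements `sh_n (a_0 ⊗ a_1 ⊗ ⋯ ⊗ a_n)`. It is an `A`-submodule, `A` acting on `a_0`. -/
def shuffleSubmodule (n : ℕ) : Submodule A (HC k A A n) :=
  generated (selfAction k A)
    (fun n => LinearMap.range (groupAlgebraAction k A A A (totalShuffle k n))) n

/-- `CHarr_n(A) = C_n(A) / Sh_n(A)`. -/
abbrev CHarr (n : ℕ) : Type (max u v) := HC k A A n ⧸ shuffleSubmodule k A n

/-- The boundary map of `CHarr_⋆(A)`, induced from the Hochschild boundary. -/
def harrD (n : ℕ) : CHarr k A (n + 1) →ₗ[A] CHarr k A n :=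
  Submodule.mapQ _ _ (hochD (selfAction k A) n)
    (fun z hz => hochD_mem_generated (selfAction k A) _ n z hz)

lemma harrD_harrD (n : ℕ) : (harrD k A n).comp (harrD k A (n + 1)) = 0 := by
  refine Submodule.linearMap_qext _ (LinearMap.ext fun z => ?_)
  change Submodule.Quotient.mk (hochD (selfAction k A) n (hochD (selfAction k A) (n + 1) z)) = 0
  rw [hochD_hochD]
  rfl

variable (M : Type w) [AddCommGroup M] [Module k M] [Module A M] [IsScalarTower k A M]

/-- The Harrison complex `CHarr_⋆(A, M) = M ⊗_A CHarr_⋆(A)` of `A` with coefficients in the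
symmetric `A`-bimodule `M`, as a chain complex of `k`-modules. -/
def harrisonComplex : ChainComplex (ModuleCat.{max u v w} k) ℕ :=
  ChainComplex.of (fun n => ModuleCat.of k (M ⊗[A] CHarr k A n))
    (fun n => ModuleCat.ofHom (((harrD k A n).lTensor M).restrictScalars k))
    (fun n => by
      ext z
      change (harrD k A n).lTensor M ((harrD k A (n + 1)).lTensor M z) = 0
      rw [← LinearMap.comp_apply, ← LinearMap.lTensor_comp, harrD_harrD, LinearMap.lTensor_zero]
      rfl)

/-- Harrison homology `Harr_n(A, M)`. -/
abbrev harrisonHomology (n : ℕ) : ModuleCat.{max u v w} k := (harrisonComplex k A M).homology n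

end Harrison

/-! ### The normalized Harrison complex of an augmented commutative algebra -/

section Augmented

variable {k : Type u} [CommRing k] {A : Type v} [CommRing A] [Algebra k A]

/-- The augmentation ideal `I = ker ε`, as a non-unital `k`-algebra. -/
def augmentationIdeal (ε : A →ₐ[k] k) : NonUnitalSubalgebra k A :=
  { (RingHom.ker ε).restrictScalars k with
    mul_mem' := fun {_ _} _ hb => (RingHom.ker ε).mul_mem_left _ hb }

variable (M : Type w) [AddCommGroup M] [Module k M] [Module A M] [IsScalarTower k A M]

/-- The action of the augmentation ideal on an `A`-module. -/
def idealAction (ε : A →ₐ[k] k) : augmentationIdeal ε →ₙₐ[k] Module.End k M :=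
  ((Algebra.lsmul k k M : A →ₐ[k] Module.End k M) : A →ₙₐ[k] Module.End k M).comp
    (NonUnitalSubalgebraClass.subtype (augmentationIdeal ε))

/-- The normalized Harrison complex `e_⋆^{(1)} C_⋆(I, M)`, where `C_n(I, M) = M ⊗ I^{⊗ n}`. -/
def normalizedHarrisonComplex [Algebra ℚ k] (ε : A →ₐ[k] k) :
    ChainComplex (ModuleCat.{max u v w} k) ℕ :=
  eulerianComplex (idealAction M ε) 1

end Augmented

end NormHarr

end

noncomputable section

namespace NormHarr

universe u v w x

open scoped TensorProduct
open CategoryTheory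

/-! ### Stable sorting -/

section StableSort

variable {α : Type*} [LinearOrder α] {β : Type*} [LinearOrder β] {n : ℕ}

/-! The `m`-th Adams operation ψ^m on `B^{⊗ n}` is the signed sum, over all labellings `f : Fin n →
Fin m`, of the permutation that sorts the positions stably by their label (`sortSum`). The
labellings sorted by a given σ are counted by a binomial coefficient in `m` and the descents of σ,
so in positive degree ψ^m is the Eulerian generating polynomial at `X = m`: ψ^m = ∑ m^i e^{(i)}.
Sorting twice is one lexicographic sort, whence ψ^a ψ^b = ψ^{ab}, and Lagrange interpolation
recovers each e^{(i)} from the ψ^m. Hence ψ^2 acts on e^{(i)} by 2^i.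

Two-valued labellings are shuffles, so ψ^2 = sh + 2 in positive degree. Thus sh acts on e^{(i)} by
2^i - 2, which is zero for i = 1 and invertible otherwise: e^{(1)} sh = 0 and 1 - e^{(1)} is a right
multiple of sh. The image of sh is then the kernel of e^{(1)}, and C(A)/Sh(A) is split off from C(A)
by e^{(1)}, linearly over A. This survives M ⊗_A.

Each ψ^m with m ≥ 1 commutes with the Hochschild boundary (`hochD_groupAlgebraAction_sortSum_succ`):
inner faces cancel or match because B is commutative, outer faces telescope because M is symmetric.
So e^{(1)} is a chain map (`hochD_eulerian`), and M ⊗_A CHarr(A) is e^{(1)} C(A,M).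

It remains to replace A by I. The projection a ↦ a - ε(a) induces a chain map C(A,M) → C(I,M) that
retracts the inclusion (`hcMap_proj_hochD`). A chain differs from its projection by a degenerate
chain, and degenerate cycles are boundaries (`exists_hochD_eq_of_mem_degenerate`). These maps act
factor by factor, so they commute with e^{(1)}, and the induced comparison is an isomorphism on
homology. -/

lemma sort_lt_iff (f : Fin n → α) (i j : Fin n) :
    i < j ↔ f (Tuple.sort f i) < f (Tuple.sort f j) ∨
      f (Tuple.sort f i) = f (Tuple.sort f j) ∧ Tuple.sort f i < Tuple.sort f j := by
  obtain ⟨h1, h2⟩ := Tuple.eq_sort_iff.1 (rfl : Tuple.sort f = Tuple.sort f)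
  have key : ∀ a b : Fin n, a < b → f (Tuple.sort f a) < f (Tuple.sort f b) ∨
      f (Tuple.sort f a) = f (Tuple.sort f b) ∧ Tuple.sort f a < Tuple.sort f b := fun a b hab => by
    rcases (h1 hab.le).lt_or_eq with h | h
    · exact Or.inl h
    · exact Or.inr ⟨h, h2 a b hab h⟩
  refine ⟨key i j, fun h => ?_⟩
  rcases lt_trichotomy i j with hij | rfl | hij
  · exact hij
  · simp at h
  · rcases key j i hij with h' | h' <;> rcases h with h | h
    · exact absurd h h'.asymm
    · exact absurd h.1 h'.ne'
    · exact absurd h'.1 h.ne'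
    · exact absurd h.2 h'.2.asymm

lemma sort_symm_lt_iff (f : Fin n → α) (p q : Fin n) :
    (Tuple.sort f)⁻¹ p < (Tuple.sort f)⁻¹ q ↔ f p < f q ∨ f p = f q ∧ p < q := by
  rw [sort_lt_iff f]
  simp

/-- Stability makes the sort unique: the pairs `(f p, p)` are distinct, so only one permutation
lists them in lexicographic order. Most later identities between sorting permutations are checked
this way. -/
lemma eq_sort_of {f : Fin n → α} {σ : Equiv.Perm (Fin n)}
    (h : ∀ i j, i < j → f (σ i) < f (σ j) ∨ f (σ i) = f (σ j) ∧ σ i < σ j) :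
    σ = Tuple.sort f := by
  refine Tuple.eq_sort_iff.2 ⟨fun i j hij => ?_, fun i j hij he => ?_⟩
  · rcases hij.lt_or_eq with h' | rfl
    · rcases h i j h' with h | h
      · exact h.le
      · exact h.1.le
    · exact le_rfl
  · rcases h i j hij with h | h
    · exact absurd he h.ne
    · exact h.2

lemma sort_comp_strictMono {e : α → β} (he : StrictMono e) (f : Fin n → α) :
    Tuple.sort (e ∘ f) = Tuple.sort f := by
  refine (eq_sort_of fun i j hij => ?_).symm
  rcases (sort_lt_iff f i j).1 hij with h | h
  · exact Or.inl (he h)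
  · exact Or.inr ⟨congrArg e h.1, h.2⟩

/-- Radix sort: sorting by `f` and then stably by `g` is a single stable sort with `g` as the
dominant key. The labels `g` are read at the places reached after the first sort, hence the inverse.
-/
lemma sort_mul_sort (f : Fin n → α) (g : Fin n → β) :
    Tuple.sort (fun p => toLex (g ((Tuple.sort f)⁻¹ p), f p) : Fin n → β ×ₗ α)
      = Tuple.sort f * Tuple.sort g := by
  refine (eq_sort_of fun i j hij => ?_).symm
  simp only [Prod.Lex.toLex_lt_toLex, Equiv.Perm.mul_apply, Equiv.Perm.coe_inv,
    Equiv.symm_apply_apply, toLex_inj, Prod.mk.injEq]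
  rcases (sort_lt_iff g i j).1 hij with h | h
  · exact Or.inl (Or.inl h)
  · rcases (sort_lt_iff f _ _).1 h.2 with h' | h'
    · exact Or.inl (Or.inr ⟨h.1, h'⟩)
    · exact Or.inr ⟨⟨h.1, h'.1⟩, h'.2⟩

/-- Distinct labels are essential: equal ones would leave `f`, and so its sort, unchanged. The sign
change it yields drives the cancellation in `sum_mergeTuple_sort`. -/
lemma sort_swap (f : Fin (n + 1) → α) (p : Fin n) (hp : f p.castSucc ≠ f p.succ) :
    Tuple.sort (f ∘ Equiv.swap p.castSucc p.succ)
      = Equiv.swap p.castSucc p.succ * Tuple.sort f := by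
  refine (eq_sort_of fun i j hij => ?_).symm
  simp only [Function.comp_apply, Equiv.Perm.mul_apply, Equiv.swap_apply_self]
  rcases (sort_lt_iff f i j).1 hij with h | h
  · exact Or.inl h
  · refine Or.inr ⟨h.1, ?_⟩
    have h1 : ¬ (Tuple.sort f i = p.castSucc ∧ Tuple.sort f j = p.succ) := by
      rintro ⟨ha, hb⟩
      rw [ha, hb] at h
      exact hp h.1
    have h2 := h.2
    revert h1 h2
    generalize Tuple.sort f i = a
    generalize Tuple.sort f j = b
    intro h1 h2
    simp only [Equiv.swap_apply_def, Fin.ext_iff, Fin.lt_def, Fin.val_castSucc, Fin.val_succ] at *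
    have c1 := Fin.val_castSucc p
    have c2 := Fin.val_succ p
    split_ifs <;> omega

/-- The permutation sending `r` to `p` and `r.succAbove a` to `p.succAbove (τ a)`. -/
def insertPerm (r p : Fin (n + 1)) (τ : Equiv.Perm (Fin n)) : Equiv.Perm (Fin (n + 1)) :=
  p.cycleRange⁻¹ * Equiv.Perm.decomposeFin.symm (0, τ) * r.cycleRange

lemma insertPerm_self (r p : Fin (n + 1)) (τ : Equiv.Perm (Fin n)) :
    insertPerm r p τ r = p := by
  simp [insertPerm, Equiv.Perm.inv_def]

lemma insertPerm_succAbove (r p : Fin (n + 1)) (τ : Equiv.Perm (Fin n)) (a : Fin n) :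
    insertPerm r p τ (r.succAbove a) = p.succAbove (τ a) := by
  simp [insertPerm, Equiv.Perm.inv_def]

lemma insertPerm_inv_succAbove (r p : Fin (n + 1)) (τ : Equiv.Perm (Fin n)) (a : Fin n) :
    (insertPerm r p τ)⁻¹ (p.succAbove a) = r.succAbove (τ⁻¹ a) := by
  rw [Equiv.Perm.inv_eq_iff_eq, insertPerm_succAbove, Equiv.Perm.coe_inv, Equiv.apply_symm_apply]

/-- `r.cycleRange` is a cycle of length `r + 1`, of sign `(-1)^r`. These signs convert the sign of a
face at `p` into that of a face at `r`. -/
lemma sign_insertPerm (r p : Fin (n + 1)) (τ : Equiv.Perm (Fin n)) :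
    (Equiv.Perm.sign (insertPerm r p τ) : ℤ)
      = (-1) ^ (r : ℕ) * (-1) ^ (p : ℕ) * (Equiv.Perm.sign τ : ℤ) := by
  simp [insertPerm]
  ring

/-- Sorting with the entry at `p` removed. -/
lemma sort_eq_insertPerm (f : Fin (n + 1) → α) (p : Fin (n + 1)) :
    Tuple.sort f = insertPerm ((Tuple.sort f)⁻¹ p) p (Tuple.sort (f ∘ p.succAbove)) := by
  set g := f ∘ p.succAbove with hg
  have mono : ∀ a b : Fin n, (Tuple.sort f)⁻¹ (p.succAbove (Tuple.sort g a))
      < (Tuple.sort f)⁻¹ (p.succAbove (Tuple.sort g b)) ↔ a < b := fun a b => by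
    rw [sort_symm_lt_iff, sort_lt_iff g]
    simp [hg]
  set r := (Tuple.sort f)⁻¹ p with hr
  have hne : ∀ a, r ≠ (Tuple.sort f)⁻¹ (p.succAbove (Tuple.sort g a)) := fun a h =>
    (Fin.succAbove_ne _ _) ((Equiv.injective _ h).symm)
  choose t ht using fun a => Fin.exists_succAbove_eq (hne a).symm
  have htm : StrictMono t := fun a b hab => by
    have := (mono a b).2 hab
    rw [← ht, ← ht] at this
    exact (Fin.strictMono_succAbove r).lt_iff_lt.1 this
  -- A strictly increasing self-map of `Fin n` is an order automorphism, and the identity is the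
  -- only one.
  have hti : ∀ a, t a = a := fun a => by
    have := Subsingleton.elim (htm.orderIsoOfSurjective t
      (Finite.surjective_of_injective htm.injective)) (OrderIso.refl _)
    exact DFunLike.congr_fun this a
  ext1 i
  rcases Fin.eq_self_or_eq_succAbove r i with rfl | ⟨a, rfl⟩
  · rw [insertPerm_self, hr, Equiv.Perm.coe_inv, Equiv.apply_symm_apply]
  · rw [insertPerm_succAbove]
    have := ht a
    rw [hti, Equiv.Perm.eq_inv_iff_eq] at this
    exact this

lemma sort_inv_val (f : Fin n → α) (p : Fin n) :
    ((Tuple.sort f)⁻¹ p : ℕ)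
      = (Finset.univ.filter fun q => f q < f p ∨ f q = f p ∧ q < p).card := by
  rw [← Fin.card_Iio, ← Finset.card_map (Tuple.sort f).toEmbedding]
  congr 1
  ext q
  simp only [Finset.mem_map_equiv, Finset.mem_Iio, Finset.mem_filter, Finset.mem_univ, true_and]
  rw [← sort_symm_lt_iff]
  rfl

lemma sort_inv_val_succAbove (f : Fin (n + 1) → α) (p : Fin (n + 1)) :
    ((Tuple.sort f)⁻¹ p : ℕ) = (Finset.univ.filter fun a : Fin n =>
      f (p.succAbove a) < f p ∨ f (p.succAbove a) = f p ∧ p.succAbove a < p).card := by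
  rw [sort_inv_val, ← Finset.card_map p.succAboveEmb]
  congr 1
  ext q
  simp only [Finset.mem_map, Finset.mem_filter, Finset.mem_univ, true_and, Fin.succAboveEmb_apply]
  rcases Fin.eq_self_or_eq_succAbove p q with rfl | ⟨a, rfl⟩
  · simp [Fin.succAbove_ne]
  · simp

end StableSort

/-! ### The sorting operators in the group algebra -/

section SortSum

/-- The signed sum of the sorting permutations of all maps `Fin n → α`. For `α = Fin m` this is
the `m`-th Adams operation. -/
def sortSum (k : Type*) [CommRing k] (α : Type*) [LinearOrder α] [Fintype α] (n : ℕ) :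
    MonoidAlgebra k (Equiv.Perm (Fin n)) :=
  ∑ f : Fin n → α, MonoidAlgebra.single (Tuple.sort f) ((Equiv.Perm.sign (Tuple.sort f) : ℤ) : k)

variable (k : Type*) [CommRing k] {α : Type*} [LinearOrder α] [Fintype α]
  {β : Type*} [LinearOrder β] [Fintype β] (n : ℕ)

lemma sortSum_congr (e : α ≃o β) : sortSum k α n = sortSum k β n := by
  refine Fintype.sum_equiv (Equiv.arrowCongr (Equiv.refl _) e.toEquiv) _ _ fun f => ?_
  have : (Equiv.arrowCongr (Equiv.refl (Fin n)) e.toEquiv) f = e ∘ f := rfl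
  rw [this, sort_comp_strictMono e.strictMono]

/-- By radix sort, pairs `(f, g)` correspond to labellings in the lexicographic product, and signs
multiply. The labelling `g` is recovered by reading the dominant key along the sort of `f`. -/
lemma sortSum_mul_sortSum :
    sortSum k α n * sortSum k β n = sortSum k (β ×ₗ α) n := by
  simp only [sortSum]
  rw [Finset.sum_mul_sum, ← Finset.sum_product', Finset.univ_product_univ]
  refine Finset.sum_bij' (fun fg _ => fun p => toLex (fg.2 ((Tuple.sort fg.1)⁻¹ p), fg.1 p))
    (fun h _ => (fun p => (ofLex (h p)).2,
      fun q => (ofLex (h (Tuple.sort (fun p => (ofLex (h p)).2) q))).1))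
    (by simp) (by simp) ?_ ?_ ?_
  · rintro ⟨f, g⟩ -
    simp
  · rintro h -
    simp
  · rintro ⟨f, g⟩ -
    rw [sort_mul_sort, MonoidAlgebra.single_mul_single, map_mul]
    push_cast
    rfl

lemma sortSum_fin_mul (a b : ℕ) :
    sortSum k (Fin a) n * sortSum k (Fin b) n = sortSum k (Fin (a * b)) n := by
  rw [sortSum_mul_sortSum]
  refine (sortSum_congr k n (Fintype.orderIsoFinOfCardEq _ ?_)).symm
  rw [← Fintype.card_congr (toLex : Fin b × Fin a ≃ Fin b ×ₗ Fin a)]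
  simp [mul_comm]

lemma sortSum_eq (m : ℕ) : sortSum k (Fin m) n = ∑ σ : Equiv.Perm (Fin n),
    MonoidAlgebra.single σ (((Equiv.Perm.sign σ : ℤ) : k) *
      ((Finset.univ.filter fun f : Fin n → Fin m => Tuple.sort f = σ).card : k)) := by
  rw [sortSum, ← Finset.sum_fiberwise (s := Finset.univ)
    (g := fun f : Fin n → Fin m => Tuple.sort f)]
  refine Finset.sum_congr rfl fun σ _ => ?_
  rw [Finset.sum_congr rfl (g := fun _ => MonoidAlgebra.single σ ((Equiv.Perm.sign σ : ℤ) : k))]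
  · rw [Finset.sum_const, mul_comm, ← nsmul_eq_mul, MonoidAlgebra.smul_single]
  · intro f hf
    rw [(Finset.mem_filter.1 hf).2]

end SortSum

/-! ### Counting the labellings with a given sorting permutation -/

section Count

variable {n : ℕ}

/-- The number of descents of `σ` at positions before `a`. -/
def descentsBefore (σ : Equiv.Perm (Fin n)) (a : ℕ) : ℕ :=
  (Finset.univ.filter fun p : Fin n × Fin n =>
    (p.1.val + 1 = p.2.val ∧ σ p.2 < σ p.1) ∧ p.2.val ≤ a).card

lemma descentsBefore_zero (σ : Equiv.Perm (Fin n)) : descentsBefore σ 0 = 0 := by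
  rw [descentsBefore, Finset.card_eq_zero, Finset.filter_eq_empty_iff]
  rintro p -
  omega

lemma descentsBefore_succ (σ : Equiv.Perm (Fin n)) (a : ℕ) (ha : a + 1 < n) :
    descentsBefore σ (a + 1) = descentsBefore σ a +
      if σ ⟨a + 1, ha⟩ < σ ⟨a, by omega⟩ then 1 else 0 := by
  split_ifs with h
  · rw [descentsBefore, descentsBefore, ← Finset.card_insert_of_notMem
      (a := ((⟨a, by omega⟩ : Fin n), (⟨a + 1, ha⟩ : Fin n)))]
    · congr 1
      ext ⟨p, q⟩
      simp only [Finset.mem_filter, Finset.mem_univ, true_and, Finset.mem_insert, Prod.mk.injEq,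
        Fin.ext_iff]
      constructor
      · rintro ⟨⟨h1, h2⟩, h3⟩
        by_cases hq : q.val ≤ a
        · exact Or.inr ⟨⟨h1, h2⟩, hq⟩
        · left; omega
      · rintro (⟨h1, h2⟩ | ⟨⟨h1, h2⟩, h3⟩)
        · have hp : p = ⟨a, by omega⟩ := Fin.ext h1
          have hq : q = ⟨a + 1, ha⟩ := Fin.ext h2
          refine ⟨⟨by omega, ?_⟩, by omega⟩
          rw [congrArg σ hp, congrArg σ hq]
          exact h
        · exact ⟨⟨h1, h2⟩, by omega⟩
    · simp
  · rw [add_zero, descentsBefore, descentsBefore]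
    congr 1
    ext ⟨p, q⟩
    simp only [Finset.mem_filter, Finset.mem_univ, true_and]
    constructor
    · rintro ⟨⟨h1, h2⟩, h3⟩
      refine ⟨⟨h1, h2⟩, ?_⟩
      by_contra hq
      have hp : p = ⟨a, by omega⟩ := Fin.ext (by simp; omega)
      have hq : q = ⟨a + 1, ha⟩ := Fin.ext (by simp; omega)
      rw [congrArg σ hp, congrArg σ hq] at h2
      exact h h2
    · rintro ⟨⟨h1, h2⟩, h3⟩
      exact ⟨⟨h1, h2⟩, by omega⟩

lemma descentsBefore_last (σ : Equiv.Perm (Fin n)) : descentsBefore σ (n - 1) = descents σ := by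
  rw [descentsBefore, descents]
  congr 1
  ext ⟨p, q⟩
  simp only [Finset.mem_filter, Finset.mem_univ, true_and, and_iff_left_iff_imp]
  omega

lemma descentsBefore_le (σ : Equiv.Perm (Fin n)) (a : ℕ) (ha : a < n) :
    descentsBefore σ a ≤ a := by
  induction a with
  | zero => rw [descentsBefore_zero]
  | succ a ih =>
    have := ih (by omega)
    rw [descentsBefore_succ σ a ha]
    split_ifs <;> omega

lemma descentsBefore_add_le (σ : Equiv.Perm (Fin n)) (a b : ℕ) (hab : a ≤ b) (hb : b < n) :
    descentsBefore σ b + a ≤ descentsBefore σ a + b := by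
  induction b, hab using Nat.le_induction with
  | base => exact le_rfl
  | succ b hab ih =>
    have := ih (by omega)
    rw [descentsBefore_succ σ b hb]
    split_ifs <;> omega

lemma descentsBefore_mono (σ : Equiv.Perm (Fin n)) (a b : ℕ) (hab : a ≤ b) :
    descentsBefore σ a ≤ descentsBefore σ b := by
  refine Finset.card_le_card fun p => ?_
  simp only [Finset.mem_filter, Finset.mem_univ, true_and]
  exact fun h => ⟨h.1, h.2.trans hab⟩

/-- Lexicographic increase of `(f (σ i), σ i)` need only be tested on neighbours. A tie in the first
key is allowed exactly when σ ascends, so labels must jump at each descent. -/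
lemma sort_eq_iff_succ {m : ℕ} (f : Fin (n + 1) → Fin m) (σ : Equiv.Perm (Fin (n + 1))) :
    Tuple.sort f = σ ↔ ∀ i : Fin n, (f (σ i.castSucc) : ℕ)
      + (if σ i.succ < σ i.castSucc then 1 else 0) ≤ f (σ i.succ) := by
  have h1 : ∀ i : Fin n, (f (σ i.castSucc) : ℕ)
      + (if σ i.succ < σ i.castSucc then 1 else 0) ≤ f (σ i.succ) ↔
      toLex (f (σ i.castSucc), σ i.castSucc) < toLex (f (σ i.succ), σ i.succ) := fun i => by
    have hne : σ i.succ ≠ σ i.castSucc := by simp [Fin.ext_iff]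
    rw [Prod.Lex.toLex_lt_toLex]
    simp only [Fin.lt_def, Fin.ext_iff, ne_eq] at *
    split_ifs <;> omega
  simp only [h1]
  rw [← Fin.strictMono_iff_lt_succ (f := fun i => toLex (f (σ i), σ i))]
  constructor
  · rintro rfl i j hij
    exact Prod.Lex.toLex_lt_toLex.2 ((sort_lt_iff f i j).1 hij)
  · intro h
    exact (eq_sort_of fun i j hij => Prod.Lex.toLex_lt_toLex.1 (h hij)).symm

lemma strictMono_add_le {N : ℕ} {c : Fin (n + 1) → Fin N} (hc : StrictMono c) (a b : Fin (n + 1))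
    (hab : a ≤ b) : (c a : ℕ) + b ≤ c b + a := by
  have : Monotone fun a : Fin (n + 1) => (c a : ℤ) - a := by
    refine Fin.monotone_iff_le_succ.2 fun i => ?_
    have := Fin.lt_def.1 (hc (Fin.castSucc_lt_succ (i := i)))
    simp only [Fin.val_castSucc, Fin.val_succ]
    push_cast
    omega
  have := this hab
  simp only at this
  omega

/-- Maps sorted by `σ` correspond to strictly increasing maps. -/
def sortFiberEquiv (m : ℕ) (σ : Equiv.Perm (Fin (n + 1))) :
    {f : Fin (n + 1) → Fin m // Tuple.sort f = σ} ≃ (Fin (n + 1) ↪o Fin (m + n - descents σ)) where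
  toFun f := OrderEmbedding.ofStrictMono
    -- Along σ the labels increase weakly, and strictly at descents. Adding `a` makes every step
    -- strict; subtracting the descents so far removes the excess, and the top value drops by
    -- `descents σ`.
    (fun a => ⟨f.1 (σ a) + a - descentsBefore σ a, by
      have h1 := descentsBefore_add_le σ a n (by omega) (by omega)
      have h2 := descentsBefore_last σ
      have h3 := (f.1 (σ a)).isLt
      have h4 := descentsBefore_le σ a a.isLt
      simp only [Nat.add_sub_cancel] at h2
      omega⟩) (by
    refine Fin.strictMono_iff_lt_succ.2 fun i => ?_
    have h1 := (sort_eq_iff_succ f.1 σ).1 f.2 i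
    have h2 := descentsBefore_succ σ i (by omega)
    have h3 := descentsBefore_le σ i (by omega)
    have h4 : (⟨i, by omega⟩ : Fin (n + 1)) = i.castSucc := rfl
    have h5 : (⟨i + 1, by omega⟩ : Fin (n + 1)) = i.succ := rfl
    rw [h4, h5] at h2
    simp only [Fin.lt_def, Fin.val_castSucc, Fin.val_succ] at *
    omega)
  invFun c := ⟨fun p =>
    ⟨c (σ⁻¹ p) + descentsBefore σ (σ⁻¹ p : Fin (n + 1)) - (σ⁻¹ p : Fin (n + 1)), by
      have h1 := strictMono_add_le c.strictMono (σ⁻¹ p) (Fin.last n) (Fin.le_last _)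
      have h2 := descentsBefore_last σ
      have h3 := (c (Fin.last n)).isLt
      have h4 := descentsBefore_mono σ (σ⁻¹ p : Fin (n + 1)) n (by omega)
      have h5 := strictMono_add_le c.strictMono 0 (σ⁻¹ p) (Fin.zero_le _)
      simp only [Nat.add_sub_cancel, Fin.val_last, Fin.val_zero] at *
      omega⟩, by
    refine (sort_eq_iff_succ _ σ).2 fun i => ?_
    have h1 := strictMono_add_le c.strictMono i.castSucc i.succ Fin.castSucc_lt_succ.le
    have h2 := descentsBefore_succ σ i (by omega)
    have h6 := strictMono_add_le c.strictMono 0 i.castSucc (Fin.zero_le _)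
    have h4 : (⟨i, by omega⟩ : Fin (n + 1)) = i.castSucc := rfl
    have h5 : (⟨i + 1, by omega⟩ : Fin (n + 1)) = i.succ := rfl
    rw [h4, h5] at h2
    simp only [Equiv.Perm.coe_inv, Equiv.symm_apply_apply, Fin.val_castSucc, Fin.val_succ,
      Fin.val_zero] at *
    omega⟩
  left_inv f := by
    refine Subtype.ext (funext fun p => Fin.ext ?_)
    have h4 := descentsBefore_le σ (σ⁻¹ p : Fin (n + 1)) (σ⁻¹ p : Fin (n + 1)).isLt
    simp only [OrderEmbedding.coe_ofStrictMono, Equiv.Perm.coe_inv, Equiv.apply_symm_apply] at *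
    omega
  right_inv c := by
    refine RelEmbedding.ext fun a => Fin.ext ?_
    have h5 := strictMono_add_le c.strictMono 0 a (Fin.zero_le _)
    simp only [OrderEmbedding.coe_ofStrictMono, Equiv.Perm.coe_inv, Equiv.symm_apply_apply,
      Fin.val_zero] at *
    omega

lemma card_sort_eq (m : ℕ) (σ : Equiv.Perm (Fin (n + 1))) :
    (Finset.univ.filter fun f : Fin (n + 1) → Fin m => Tuple.sort f = σ).card
      = (m + n - descents σ).choose (n + 1) := by
  rw [← Fintype.card_subtype, ← Nat.card_eq_fintype_card,
    Nat.card_congr ((sortFiberEquiv m σ).trans Set.powersetCard.ofFinEmbEquiv),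
    Set.powersetCard.card, Nat.card_fin]

/-- The bound on `d` makes `m + n - d` a true subtraction. When this number is at most `n`, the
product has a zero factor and the binomial coefficient vanishes too. -/
lemma binomPoly_eval (m d : ℕ) (hd : d ≤ n) :
    (binomPoly (n + 1) d).eval (m : ℚ) = ((m + n - d).choose (n + 1) : ℚ) := by
  have h1 : ∏ j ∈ Finset.range (n + 1), ((m : ℚ) + ((n + 1 : ℕ) - 1 - d - j))
      = ((m + n - d).descFactorial (n + 1) : ℚ) := by
    rw [← descPochhammer_eval_eq_descFactorial, descPochhammer_eval_eq_prod_range]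
    refine Finset.prod_congr rfl fun j _ => ?_
    push_cast [Nat.cast_sub (show d ≤ m + n by omega)]
    ring
  rw [binomPoly, Polynomial.eval_mul, Polynomial.eval_C, Polynomial.eval_prod]
  simp only [Polynomial.eval_add, Polynomial.eval_X, Polynomial.eval_C]
  rw [h1, Nat.descFactorial_eq_factorial_mul_choose, Nat.cast_mul, inv_mul_cancel_left₀]
  exact_mod_cast Nat.factorial_ne_zero _

lemma natDegree_binomPoly_le (n d : ℕ) : (binomPoly n d).natDegree ≤ n := by
  refine (Polynomial.natDegree_C_mul_le _ _).trans ((Polynomial.natDegree_prod_le _ _).trans ?_)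
  refine (Finset.sum_le_card_nsmul _ _ 1 fun j _ => ?_).trans (by simp)
  exact (Polynomial.natDegree_X_add_C _).le

lemma descents_le (σ : Equiv.Perm (Fin (n + 1))) : descents σ ≤ n := by
  rw [← descentsBefore_last σ]
  exact descentsBefore_le σ _ (by omega)

end Count

/-! ### Eulerian idempotents as combinations of Adams operations -/

section Eulerian

variable {n : ℕ}

lemma single_sum {k G ι : Type*} [CommRing k] (s : Finset ι) (g : G) (c : ι → k) :
    MonoidAlgebra.single g (∑ i ∈ s, c i) = ∑ i ∈ s, MonoidAlgebra.single g (c i) :=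
  map_sum (MonoidAlgebra.singleAddHom g) c s

/-- This is ψ^m = ∑ m^i e^{(i)}: the generating polynomial of the Eulerian idempotents evaluated at
`X = m`. -/
lemma sortSum_eq_eval (k : Type*) [CommRing k] [Algebra ℚ k] (m : ℕ) :
    sortSum k (Fin m) (n + 1) = ∑ σ : Equiv.Perm (Fin (n + 1)),
      MonoidAlgebra.single σ (algebraMap ℚ k
        (((Equiv.Perm.sign σ : ℤ) : ℚ) * (binomPoly (n + 1) (descents σ)).eval (m : ℚ))) := by
  rw [sortSum_eq]
  refine Finset.sum_congr rfl fun σ _ => ?_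
  rw [card_sort_eq, binomPoly_eval _ _ (descents_le σ)]
  simp

/-- Lagrange interpolation at `0, …, N`. The weights depend on `i` and `N` only, so they serve all
polynomials, and later all degrees, at once. -/
lemma exists_coeff_eq_sum_eval (i N : ℕ) : ∃ c : ℕ → ℚ, ∀ P : Polynomial ℚ, P.natDegree ≤ N →
    P.coeff i = ∑ m ∈ Finset.range (N + 1), c m * P.eval (m : ℚ) := by
  refine ⟨fun m => (Lagrange.basis (Finset.range (N + 1)) (fun m : ℕ => (m : ℚ)) m).coeff i,
    fun P hP => ?_⟩
  have := Lagrange.eq_interpolate (s := Finset.range (N + 1)) (v := fun m : ℕ => (m : ℚ)) (f := P)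
    (Nat.cast_injective.injOn) (by
      rw [Finset.card_range]
      exact lt_of_le_of_lt Polynomial.degree_le_natDegree (by exact_mod_cast Nat.lt_succ_of_le hP))
  conv_lhs => rw [this, Lagrange.interpolate_apply, Polynomial.finsetSum_coeff]
  refine Finset.sum_congr rfl fun m _ => ?_
  rw [Polynomial.coeff_C_mul, mul_comm]

lemma eulerianIdempotent_eq {i N : ℕ} {c : ℕ → ℚ}
    (hc : ∀ P : Polynomial ℚ, P.natDegree ≤ N →
      P.coeff i = ∑ m ∈ Finset.range (N + 1), c m * P.eval (m : ℚ)) (hn : n + 1 ≤ N) :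
    eulerianIdempotent (n + 1) i
      = ∑ m ∈ Finset.range (N + 1), c m • sortSum ℚ (Fin m) (n + 1) := by
  simp only [sortSum_eq_eval, Finset.smul_sum, eulerianIdempotent]
  rw [Finset.sum_comm]
  refine Finset.sum_congr rfl fun σ _ => ?_
  rw [hc _ ((natDegree_binomPoly_le _ _).trans hn), Finset.mul_sum, single_sum]
  refine Finset.sum_congr rfl fun m _ => ?_
  rw [MonoidAlgebra.smul_single]
  congr 1
  simp only [Algebra.algebraMap_self, RingHom.id_apply, smul_eq_mul]
  ring

/-- Interpolation is applied to `P(aX)`, whose `i`-th coefficient is `a^i` times that of `P`. Since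
ψ^a ψ^m = ψ^{am}, this is the eigenvalue equation for ψ^a. -/
lemma sum_smul_sortSum_mul {i N : ℕ} {c : ℕ → ℚ}
    (hc : ∀ P : Polynomial ℚ, P.natDegree ≤ N →
      P.coeff i = ∑ m ∈ Finset.range (N + 1), c m * P.eval (m : ℚ)) (hn : n + 1 ≤ N) (a : ℕ) :
    ∑ m ∈ Finset.range (N + 1), c m • sortSum ℚ (Fin (a * m)) (n + 1)
      = (a : ℚ) ^ i • eulerianIdempotent (n + 1) i := by
  simp only [sortSum_eq_eval, Finset.smul_sum, eulerianIdempotent]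
  rw [Finset.sum_comm]
  refine Finset.sum_congr rfl fun σ _ => ?_
  have h := hc ((binomPoly (n + 1) (descents σ)).comp (Polynomial.C (a : ℚ) * Polynomial.X))
    (by
      refine (Polynomial.natDegree_comp_le).trans ?_
      refine (Nat.mul_le_mul (natDegree_binomPoly_le _ _) ((Polynomial.natDegree_C_mul_le _ _).trans
        Polynomial.natDegree_X_le)).trans ?_
      omega)
  rw [Polynomial.comp_C_mul_X_coeff] at h
  simp only [MonoidAlgebra.smul_single]
  rw [← single_sum]
  congr 1
  rw [smul_eq_mul, mul_left_comm, mul_comm ((a : ℚ) ^ i), h, Finset.mul_sum]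
  refine Finset.sum_congr rfl fun m _ => ?_
  simp
  ring

lemma sortSum_two_mul_eulerianIdempotent (i : ℕ) :
    sortSum ℚ (Fin 2) (n + 1) * eulerianIdempotent (n + 1) i
      = (2 : ℚ) ^ i • eulerianIdempotent (n + 1) i := by
  obtain ⟨c, hc⟩ := exists_coeff_eq_sum_eval i (n + 1)
  have := sum_smul_sortSum_mul hc le_rfl 2
  rw [Nat.cast_ofNat] at this
  rw [← this, eulerianIdempotent_eq hc le_rfl, Finset.mul_sum]
  refine Finset.sum_congr rfl fun m _ => ?_
  rw [mul_smul_comm, sortSum_fin_mul]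

lemma eulerianIdempotent_mul_sortSum_two (i : ℕ) :
    eulerianIdempotent (n + 1) i * sortSum ℚ (Fin 2) (n + 1)
      = (2 : ℚ) ^ i • eulerianIdempotent (n + 1) i := by
  obtain ⟨c, hc⟩ := exists_coeff_eq_sum_eval i (n + 1)
  have := sum_smul_sortSum_mul hc le_rfl 2
  rw [Nat.cast_ofNat] at this
  rw [← this, eulerianIdempotent_eq hc le_rfl, Finset.sum_mul]
  refine Finset.sum_congr rfl fun m _ => ?_
  rw [smul_mul_assoc, sortSum_fin_mul, mul_comm 2]

lemma sortSum_one (k : Type*) [CommRing k] (n : ℕ) : sortSum k (Fin 1) n = 1 := by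
  have h : ∀ f : Fin n → Fin 1, Tuple.sort f = 1 := fun f =>
    Tuple.sort_eq_refl_iff_monotone.2 fun i j _ => (Subsingleton.elim _ _).le
  rw [sortSum, Fintype.sum_unique]
  simp [h, MonoidAlgebra.one_def]

/-- The generating polynomial at `X = 1`: the only labelling with one label is constant, and sorting
it does nothing. -/
lemma sum_eulerianIdempotent :
    ∑ i ∈ Finset.range (n + 2), eulerianIdempotent (n + 1) i = 1 := by
  rw [← sortSum_one, sortSum_eq_eval]
  simp only [eulerianIdempotent]
  rw [Finset.sum_comm]
  refine Finset.sum_congr rfl fun σ _ => ?_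
  rw [← single_sum, ← Finset.mul_sum, Nat.cast_one, Polynomial.eval_eq_sum_range'
    (Nat.lt_succ_of_le (natDegree_binomPoly_le (n + 1) _))]
  simp

/-- On e^{(i)} the operator ψ^2 - 2 is multiplication by 2^i - 2, invertible for i ≠ 1. Dividing
each such idempotent by its eigenvalue gives `y`. -/
lemma exists_one_eq_eulerianIdempotent_add :
    ∃ y, 1 = eulerianIdempotent (n + 1) 1 + (sortSum ℚ (Fin 2) (n + 1) - 2) * y := by
  refine ⟨∑ i ∈ (Finset.range (n + 2)).erase 1, ((2 : ℚ) ^ i - 2)⁻¹ • eulerianIdempotent (n + 1) i,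
    ?_⟩
  conv_lhs => rw [← sum_eulerianIdempotent,
    ← Finset.add_sum_erase (Finset.range (n + 2)) _ (a := 1) (by simp)]
  congr 1
  rw [Finset.mul_sum]
  refine Finset.sum_congr rfl fun i hi => ?_
  have h2 : (2 : ℚ) ^ i - 2 ≠ 0 := fun h => (Finset.mem_erase.1 hi).1 (by
    have : (2 : ℕ) ^ i = 2 ^ 1 := by exact_mod_cast sub_eq_zero.1 h
    exact Nat.pow_right_injective le_rfl this)
  have h3 : (2 : MonoidAlgebra ℚ (Equiv.Perm (Fin (n + 1)))) = (2 : ℚ) • 1 := by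
    rw [two_smul, one_add_one_eq_two]
  rw [mul_smul_comm, sub_mul, sortSum_two_mul_eulerianIdempotent, h3, smul_mul_assoc, one_mul,
    ← sub_smul, smul_smul, inv_mul_cancel₀ h2, one_smul]

/-- An `i`-shuffle sorts the labelling that is 0 on the image of the first `i` positions and 1
elsewhere; conversely `i` is the number of zeros. Pairs `(i, σ)` are counted because one σ may be a
shuffle for several `i`. -/
lemma sum_shuffleElement (k : Type*) [CommRing k] (n : ℕ) :
    ∑ i ∈ Finset.range (n + 1), shuffleElement k n i = sortSum k (Fin 2) n := by
  classical
  simp only [shuffleElement, Finset.sum_sigma', sortSum]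
  have sorted : ∀ (i : ℕ) (σ : Equiv.Perm (Fin n)), IsShuffle i σ →
      σ = Tuple.sort (fun p => if (σ⁻¹ p : Fin n).val < i then (0 : Fin 2) else 1) := by
    intro i σ h
    refine eq_sort_of fun a b hab => ?_
    simp only [Equiv.Perm.coe_inv, Equiv.symm_apply_apply]
    have hab' : a.val < b.val := hab
    by_cases ha : a.val < i
    · by_cases hb : b.val < i
      · exact Or.inr ⟨by simp [ha, hb], h a b hab (Or.inl hb)⟩
      · exact Or.inl (by simp [ha, hb])
    · have hb : ¬ b.val < i := by omega
      exact Or.inr ⟨by simp [ha, hb], h a b hab (Or.inr (by omega))⟩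
  have count : ∀ (f : Fin n → Fin 2) (a : Fin n),
      a.val < (Finset.univ.filter fun q => f q < 1).card ↔ f (Tuple.sort f a) < 1 := by
    intro f a
    have := Tuple.lt_card_lt_iff_apply_lt_of_monotone (j := a) (a := (1 : Fin 2))
      (Tuple.monotone_sort f)
    rw [Function.comp_apply] at this
    rw [← this, ← Finset.card_map (Tuple.sort f).symm.toEmbedding]
    congr! 2
    ext q
    simp [Finset.mem_map_equiv]
  refine Finset.sum_bij'
    (fun x _ => fun p => if (x.2⁻¹ p : Fin n).val < x.1 then (0 : Fin 2) else 1)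
    (fun f _ => ⟨(Finset.univ.filter fun q => f q < 1).card, Tuple.sort f⟩) (by simp) ?_ ?_ ?_ ?_
  · intro f _
    simp only [Finset.mem_sigma, Finset.mem_range, Finset.mem_filter, Finset.mem_univ, true_and]
    refine ⟨Nat.lt_succ_of_le ((Finset.card_filter_le _ _).trans (by simp)), fun a b hab h => ?_⟩
    refine (Tuple.eq_sort_iff.1 (rfl : Tuple.sort f = Tuple.sort f)).2 a b hab ?_
    have hm : f (Tuple.sort f a) ≤ f (Tuple.sort f b) := Tuple.monotone_sort f hab.le
    have ha := count f a
    have hb := count f b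
    have hab' : a.val < b.val := hab
    rcases h with h | h
    · have := hb.1 h
      omega
    · have := mt ha.2 (by omega)
      omega
  · rintro ⟨i, σ⟩ hx
    simp only [Finset.mem_sigma, Finset.mem_range, Finset.mem_filter, Finset.mem_univ,
      true_and] at hx
    refine Sigma.ext ?_ (heq_of_eq (sorted i σ hx.2).symm)
    simp only
    rw [← Finset.card_map σ⁻¹.toEmbedding]
    have : (Finset.univ.filter fun q : Fin n => q.val < i).card = i := by
      rw [Fin.card_filter_val_lt]
      omega
    conv_rhs => rw [← this]
    congr 1
    ext q
    have e : Equiv.symm σ⁻¹ = σ := rfl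
    simp [Finset.mem_map_equiv, e]
  · rintro f -
    ext p
    obtain ⟨a, rfl⟩ := (Tuple.sort f).surjective p
    have := count f a
    simp only [Equiv.Perm.coe_inv, Equiv.symm_apply_apply, this]
    split_ifs <;> simp only [Fin.val_zero, Fin.val_one] <;> omega
  · rintro ⟨i, σ⟩ hx
    simp only [Finset.mem_sigma, Finset.mem_range, Finset.mem_filter, Finset.mem_univ,
      true_and] at hx
    simp only
    rw [← sorted i σ hx.2]

lemma shuffleElement_eq_one (k : Type*) [CommRing k] (n i : ℕ) (hi : i = 0 ∨ n ≤ i) :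
    shuffleElement k n i = 1 := by
  classical
  have : (Finset.univ.filter fun σ : Equiv.Perm (Fin n) => IsShuffle i σ) = {1} := by
    ext σ
    simp only [Finset.mem_filter, Finset.mem_univ, true_and, Finset.mem_singleton]
    constructor
    · intro h
      exact (Equiv.Perm.monotone_iff σ).1 (StrictMono.monotone fun a b hab =>
        h a b hab (by omega))
    · rintro rfl a b hab -
      exact hab
  rw [shuffleElement, Finset.sum_congr (by convert! this) fun _ _ => rfl]
  simp [MonoidAlgebra.one_def]

/-- The extreme shuffles, for `0` and `n + 1`, are the identity and account for the 2. In degree 0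
they coincide, so the formula is confined to positive degree. -/
lemma totalShuffle_eq (k : Type*) [CommRing k] :
    totalShuffle k (n + 1) = sortSum k (Fin 2) (n + 1) - 2 := by
  rw [← sum_shuffleElement, Finset.sum_range_succ, Finset.range_eq_Ico,
    Finset.sum_eq_sum_Ico_succ_bot (by omega), shuffleElement_eq_one k _ 0 (Or.inl rfl),
    shuffleElement_eq_one k _ (n + 1) (Or.inr le_rfl), totalShuffle, ← one_add_one_eq_two]
  abel

lemma totalShuffle_zero (k : Type*) [CommRing k] : totalShuffle k 0 = 0 := by
  simp [totalShuffle]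

variable (k : Type*) [CommRing k] [Algebra ℚ k]

lemma eulerianElement_zero : eulerianElement k 0 1 = 1 := by
  simp [eulerianElement, eulerianIdempotent]

lemma map_sortSum (n m : ℕ) : MonoidAlgebra.mapRingHom (Equiv.Perm (Fin n)) (algebraMap ℚ k)
    (sortSum ℚ (Fin m) n) = sortSum k (Fin m) n := by
  rw [sortSum, sortSum, map_sum]
  refine Finset.sum_congr rfl fun f _ => ?_
  simp

lemma map_totalShuffle (n : ℕ) : MonoidAlgebra.mapRingHom (Equiv.Perm (Fin n)) (algebraMap ℚ k)
    (totalShuffle ℚ n) = totalShuffle k n := by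
  cases n with
  | zero => rw [totalShuffle_zero, totalShuffle_zero, map_zero]
  | succ n => rw [totalShuffle_eq, totalShuffle_eq, map_sub, map_sortSum, map_ofNat]

lemma eulerianElement_mul_totalShuffle (n : ℕ) :
    eulerianElement k n 1 * totalShuffle k n = 0 := by
  rw [eulerianElement, ← map_totalShuffle, ← map_mul]
  cases n with
  | zero => rw [totalShuffle_zero, mul_zero, map_zero]
  | succ n =>
    rw [totalShuffle_eq, mul_sub, eulerianIdempotent_mul_sortSum_two, pow_one, two_smul, mul_two,
      sub_self, map_zero]

/-- With `eulerianElement_mul_totalShuffle` this identifies the image of sh with the kernel of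
e^{(1)}. -/
lemma exists_one_eq_eulerianElement_add (n : ℕ) :
    ∃ y, 1 = eulerianElement k n 1 + totalShuffle k n * y := by
  cases n with
  | zero => exact ⟨0, by rw [eulerianElement_zero, mul_zero, add_zero]⟩
  | succ n =>
    obtain ⟨y, hy⟩ := exists_one_eq_eulerianIdempotent_add (n := n)
    refine ⟨MonoidAlgebra.mapRingHom _ (algebraMap ℚ k) y, ?_⟩
    rw [← map_totalShuffle, ← map_mul, eulerianElement, ← map_add, totalShuffle_eq, ← hy, map_one]

lemma eulerianElement_mul_self (n : ℕ) :
    eulerianElement k n 1 * eulerianElement k n 1 = eulerianElement k n 1 := by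
  obtain ⟨y, hy⟩ := exists_one_eq_eulerianElement_add k n
  conv_rhs => rw [← mul_one (eulerianElement k n 1), hy, mul_add, ← mul_assoc,
    eulerianElement_mul_totalShuffle, zero_mul, add_zero]

/-- The first Eulerian element is a combination of sorting operators, with coefficients
independent of the degree. -/
lemma exists_eulerianElement_eq (N : ℕ) : ∃ c : ℕ → k, ∀ n, n + 1 ≤ N →
    eulerianElement k (n + 1) 1
      = ∑ m ∈ Finset.range (N + 1), c m • sortSum k (Fin m) (n + 1) := by
  obtain ⟨c, hc⟩ := exists_coeff_eq_sum_eval 1 N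
  refine ⟨fun m => algebraMap ℚ k (c m), fun n hn => ?_⟩
  rw [eulerianElement, eulerianIdempotent_eq hc hn, map_sum]
  refine Finset.sum_congr rfl fun m _ => ?_
  rw [← map_sortSum k]
  ext σ
  simp [Algebra.smul_def]

end Eulerian

/-! ### Sorting operators commute with the Hochschild boundary -/

section SortBoundary

variable {k : Type u} [CommRing k]
variable {R : Type x} [CommRing R] [Algebra k R]
variable {B : Type v} [NonUnitalCommRing B] [Module k B] [IsScalarTower k B B] [SMulCommClass k B B]
variable {M : Type w} [AddCommGroup M] [Module k M] [Module R M] [IsScalarTower k R M]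
variable (φ : B →ₙₐ[k] Module.End R M) {n : ℕ}

lemma groupAlgebraAction_single (σ : Equiv.Perm (Fin n)) (c : k) (m : M) (b : Fin n → B) :
    groupAlgebraAction k R B M (MonoidAlgebra.single σ c) (m ⊗ₜ[k] PiTensorProduct.tprod k b)
      = c • (m ⊗ₜ[k] PiTensorProduct.tprod k (b ∘ ⇑σ⁻¹)) := by
  rw [groupAlgebraAction, TensorProduct.AlgebraTensorModule.lTensor_tmul, MonoidAlgebra.lift_single,
    LinearMap.smul_apply, TensorProduct.tmul_smul]
  congr 2
  exact PiTensorProduct.reindex_tprod σ b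

lemma groupAlgebraAction_mul (x y : MonoidAlgebra k (Equiv.Perm (Fin n))) :
    groupAlgebraAction k R B M (x * y)
      = groupAlgebraAction k R B M x ∘ₗ groupAlgebraAction k R B M y := by
  rw [groupAlgebraAction, map_mul]
  exact TensorProduct.AlgebraTensorModule.lTensor_comp _ _

lemma groupAlgebraAction_one : groupAlgebraAction k R B M (1 : MonoidAlgebra k (Equiv.Perm (Fin n)))
      = LinearMap.id := by
  rw [groupAlgebraAction, map_one]
  exact TensorProduct.AlgebraTensorModule.lTensor_id

lemma groupAlgebraAction_add (x y : MonoidAlgebra k (Equiv.Perm (Fin n))) :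
    groupAlgebraAction k R B M (x + y)
      = groupAlgebraAction k R B M x + groupAlgebraAction k R B M y := by
  rw [groupAlgebraAction, map_add, map_add]
  rfl

lemma groupAlgebraAction_zero :
    groupAlgebraAction k R B M (0 : MonoidAlgebra k (Equiv.Perm (Fin n))) = 0 := by
  rw [groupAlgebraAction, map_zero, map_zero]

lemma groupAlgebraAction_sum {ι : Type*} (s : Finset ι)
    (c : ι → MonoidAlgebra k (Equiv.Perm (Fin n))) :
    groupAlgebraAction k R B M (∑ i ∈ s, c i) = ∑ i ∈ s, groupAlgebraAction k R B M (c i) := by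
  simp only [groupAlgebraAction, map_sum]

lemma groupAlgebraAction_smul (c : k) (x : MonoidAlgebra k (Equiv.Perm (Fin n))) (z : HC k B M n) :
    groupAlgebraAction k R B M (c • x) z = c • groupAlgebraAction k R B M x z := by
  rw [groupAlgebraAction, map_smul]
  induction z using TensorProduct.induction_on with
  | zero => simp
  | add a b ha hb => rw [map_add, ha, hb, map_add, smul_add]
  | tmul m t =>
    rw [TensorProduct.AlgebraTensorModule.lTensor_tmul, LinearMap.smul_apply,
      TensorProduct.tmul_smul]
    rfl

lemma groupAlgebraAction_sortSum {α : Type*} [LinearOrder α] [Fintype α] (m : M) (b : Fin n → B) :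
    groupAlgebraAction k R B M (sortSum k α n) (m ⊗ₜ[k] PiTensorProduct.tprod k b)
      = ∑ f : Fin n → α, (Equiv.Perm.sign (Tuple.sort f) : ℤ) •
        (m ⊗ₜ[k] PiTensorProduct.tprod k (b ∘ ⇑(Tuple.sort f)⁻¹)) := by
  rw [sortSum, groupAlgebraAction_sum, LinearMap.sum_apply]
  refine Finset.sum_congr rfl fun f _ => ?_
  rw [groupAlgebraAction_single, Int.cast_smul_eq_zsmul]

/-- Multiply the entries at `p` and `p + 1`. -/
def mergeTuple (p : Fin n) (b : Fin (n + 1) → B) : Fin n → B := fun j =>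
  if j = p then b p.castSucc * b p.succ else b (p.succ.succAbove j)

lemma faceTuple_castSucc_succ (p : Fin n) (b : Fin (n + 1) → B) :
    faceTuple p.castSucc.succ b = mergeTuple p b := by
  ext j
  simp only [faceTuple, mergeTuple, Fin.val_succ, Fin.val_castSucc]
  rcases lt_trichotomy j p with h | rfl | h
  · have h' : j.val < p.val := h
    rw [if_pos (by omega), if_neg h.ne, Fin.succAbove_of_castSucc_lt _ _
      (Fin.lt_def.2 (by simp; omega))]
  · simp
  · have h' : p.val < j.val := h
    rw [if_neg (by omega), if_neg (by omega), if_neg h.ne', Fin.succAbove_of_le_castSucc _ _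
      (Fin.le_def.2 (by simp; omega))]

/-- Here commutativity of `B` enters. -/
lemma mergeTuple_comp_swap (p : Fin n) (b : Fin (n + 1) → B) :
    mergeTuple p (b ∘ Equiv.swap p.castSucc p.succ) = mergeTuple p b := by
  ext j
  simp only [mergeTuple, Function.comp_apply, Equiv.swap_apply_left, Equiv.swap_apply_right]
  split_ifs with h
  · rw [mul_comm]
  · rw [Equiv.swap_apply_of_ne_of_ne _ (Fin.succAbove_ne _ _)]
    rw [← Fin.succAbove_succ_self p]
    exact fun h' => h (Fin.succAbove_right_injective h')

/-- Separates the outer faces, which remove an entry, from the inner ones, which merge two: the two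
kinds interact with sorting differently. -/
lemma hochD_tmul (m : M) (b : Fin (n + 1) → B) :
    hochD φ n (m ⊗ₜ[k] PiTensorProduct.tprod k b)
      = φ (b 0) m ⊗ₜ[k] PiTensorProduct.tprod k (b ∘ (0 : Fin (n + 1)).succAbove)
        + ∑ p : Fin n, (-1 : ℤ) ^ (p + 1 : ℕ) •
            (m ⊗ₜ[k] PiTensorProduct.tprod k (mergeTuple p b))
        - (-1 : ℤ) ^ n • (φ (b (Fin.last n)) m
            ⊗ₜ[k] PiTensorProduct.tprod k (b ∘ (Fin.last n).succAbove)) := by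
  have h0 : faceTuple 0 b = b ∘ (0 : Fin (n + 1)).succAbove := by
    ext j; simp [faceTuple]
  have h1 : faceTuple (Fin.last n).succ b = b ∘ (Fin.last n).succAbove := by
    ext j; simp [faceTuple]
  have hl : (Fin.last n).succ = Fin.last (n + 1) := rfl
  rw [hochD, LinearMap.sum_apply, Fin.sum_univ_succ, Fin.sum_univ_castSucc]
  simp only [LinearMap.smul_apply, face_tmul, faceTuple_castSucc_succ, h0, h1]
  have hc : ∀ p : Fin n, faceCoeff φ p.castSucc.succ b = 1 := fun p => by
    have h1 : p.castSucc.succ ≠ Fin.last (n + 1) := by simp [Fin.ext_iff]; omega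
    rw [faceCoeff, if_neg (Fin.succ_ne_zero _), if_neg h1]
  have h00 : faceCoeff φ 0 b = φ (b 0) := by simp [faceCoeff]
  have hll : faceCoeff φ (Fin.last n).succ b = φ (b (Fin.last n)) := by
    rw [faceCoeff, if_neg (Fin.succ_ne_zero _), if_pos hl]
  simp only [hc, h00, hll, Fin.val_zero, pow_zero, one_smul, Fin.val_succ, Fin.val_castSucc,
    Fin.val_last, Module.End.one_apply, pow_succ, mul_neg, mul_one, neg_smul]
  abel

/-- Nothing can come between neighbouring positions with equal labels in a stable sort, so they stay
adjacent. -/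
lemma sort_inv_succ {α : Type*} [LinearOrder α] (f : Fin (n + 1) → α) (p : Fin n)
    (h : f p.castSucc = f p.succ) :
    (Tuple.sort f)⁻¹ p.succ = ((Tuple.sort (f ∘ p.succ.succAbove))⁻¹ p).succ := by
  refine Fin.ext ?_
  rw [Fin.val_succ, sort_inv_val_succAbove, sort_inv_val,
    ← Finset.card_insert_of_notMem (a := p) (by simp)]
  congr 1
  ext a
  simp only [Finset.mem_filter, Finset.mem_univ, true_and, Finset.mem_insert, Function.comp_apply,
    Fin.succAbove_succ_self, h]
  rcases lt_trichotomy a p with h' | rfl | h'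
  · rw [Fin.succAbove_of_castSucc_lt _ _ (Fin.lt_def.2 (by
      have := Fin.lt_def.1 h'
      simp; omega))]
    have h2 : a.castSucc < p.succ := Fin.lt_def.2 (by
      have := Fin.lt_def.1 h'
      simp; omega)
    simp [h', h'.ne, h2]
  · simp [h]
  · have h3 : p.succ ≤ a.castSucc := Fin.le_def.2 (by
      have := Fin.lt_def.1 h'
      simp; omega)
    rw [Fin.succAbove_of_le_castSucc _ _ h3]
    have h2 : ¬ a.succ < p.succ := by simpa using h'.le
    simp [h'.ne', h2, h'.not_gt]

/-- If the labels at `p` and `p + 1` differ, exchanging them flips the sign and keeps the merged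
tuple, so these terms cancel in pairs. If they agree, the two positions receive consecutive entries
`s`, `s + 1` of `b`; forgetting one label gives `g`, and merging may be done before sorting. -/
lemma sum_mergeTuple_sort {α : Type*} [LinearOrder α] [Fintype α] (m : M) (b : Fin (n + 1) → B)
    (p : Fin n) :
    ∑ f : Fin (n + 1) → α, (Equiv.Perm.sign (Tuple.sort f) : ℤ) • (-1 : ℤ) ^ (p + 1 : ℕ) •
        (m ⊗ₜ[k] PiTensorProduct.tprod k (mergeTuple p (b ∘ ⇑(Tuple.sort f)⁻¹)))
      = ∑ g : Fin n → α, (Equiv.Perm.sign (Tuple.sort g) : ℤ) •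
        (-1 : ℤ) ^ (((Tuple.sort g)⁻¹ p : Fin n) + 1 : ℕ) •
        (m ⊗ₜ[k] PiTensorProduct.tprod k
          (mergeTuple ((Tuple.sort g)⁻¹ p) b ∘ ⇑(Tuple.sort g)⁻¹)) := by
  classical
  rw [← Finset.sum_filter_add_sum_filter_not Finset.univ
    (fun f : Fin (n + 1) → α => f p.castSucc = f p.succ)]
  have hz : ∑ f : Fin (n + 1) → α with ¬ f p.castSucc = f p.succ,
      (Equiv.Perm.sign (Tuple.sort f) : ℤ) • (-1 : ℤ) ^ (p + 1 : ℕ) •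
        (m ⊗ₜ[k] PiTensorProduct.tprod k (mergeTuple p (b ∘ ⇑(Tuple.sort f)⁻¹))) = 0 := by
    refine Finset.sum_involution (fun f _ => f ∘ Equiv.swap p.castSucc p.succ) ?_ ?_ ?_ ?_
    · intro f hf
      have hne := (Finset.mem_filter.1 hf).2
      have h1 : b ∘ ⇑(Equiv.swap p.castSucc p.succ * Tuple.sort f)⁻¹
          = (b ∘ ⇑(Tuple.sort f)⁻¹) ∘ Equiv.swap p.castSucc p.succ := by
        rw [mul_inv_rev, Equiv.swap_inv]
        rfl
      have h2 : p.castSucc ≠ p.succ := by simp [Fin.ext_iff]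
      rw [sort_swap f p hne, h1, mergeTuple_comp_swap, map_mul, Equiv.Perm.sign_swap h2]
      simp
    · intro f hf _ h
      have hne := (Finset.mem_filter.1 hf).2
      have := congrFun h p.castSucc
      simp only [Function.comp_apply, Equiv.swap_apply_left] at this
      exact hne this.symm
    · intro f hf
      have hne := (Finset.mem_filter.1 hf).2
      simp only [Finset.mem_filter, Finset.mem_univ, true_and, Function.comp_apply,
        Equiv.swap_apply_left, Equiv.swap_apply_right]
      exact fun h => hne h.symm
    · intro f hf
      ext j
      simp
  rw [hz, add_zero]
  refine Finset.sum_bij' (fun f _ => f ∘ p.succ.succAbove)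
    (fun g _ => p.succ.insertNth (g p) g) (by simp) ?_ ?_ ?_ ?_
  · intro g _
    simp only [Finset.mem_filter, Finset.mem_univ, true_and, Fin.insertNth_apply_same]
    rw [← Fin.succAbove_succ_self p, Fin.insertNth_apply_succAbove]
  · intro f hf
    have h := (Finset.mem_filter.1 hf).2
    ext j
    rcases Fin.eq_self_or_eq_succAbove p.succ j with rfl | ⟨a, rfl⟩
    · simp [h]
    · simp
  · intro g _
    ext j
    simp
  · intro f hf
    have h := (Finset.mem_filter.1 hf).2
    have hs := sort_inv_succ f p h
    have he := sort_eq_insertPerm f p.succ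
    rw [hs] at he
    set g := f ∘ p.succ.succAbove with hg
    set s := (Tuple.sort g)⁻¹ p with hsd
    have ht : mergeTuple p (b ∘ ⇑(Tuple.sort f)⁻¹) = mergeTuple s b ∘ ⇑(Tuple.sort g)⁻¹ := by
      ext j
      have h1 : ∀ a, (Tuple.sort f)⁻¹ (p.succ.succAbove a)
          = s.succ.succAbove ((Tuple.sort g)⁻¹ a) := fun a => by
        rw [he, insertPerm_inv_succAbove]
      have h2 : (Tuple.sort f)⁻¹ p.castSucc = s.castSucc := by
        rw [← Fin.succAbove_succ_self p, h1, ← hsd, Fin.succAbove_succ_self]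
      simp only [mergeTuple, Function.comp_apply, h1, h2, hs]
      have h3 : (Tuple.sort g)⁻¹ j = s ↔ j = p := (Equiv.injective _).eq_iff
      simp only [h3]
    rw [ht, he, sign_insertPerm, smul_smul, smul_smul]
    congr 1
    simp only [Fin.val_succ, pow_succ]
    -- The face sign `(-1)^(p+1)` cancels against the one in `sign_insertPerm`, leaving
    -- `(-1)^(s+1)`.
    have h1 : (-1 : ℤ) ^ (p : ℕ) * (-1 : ℤ) ^ (p : ℕ) = 1 := by
      rw [← mul_pow]; simp
    linear_combination ((-1 : ℤ) ^ (s : ℕ) * (-1) * (Equiv.Perm.sign (Tuple.sort g) : ℤ)) * h1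

/-- The contribution to the boundary of removing the entry `r` and sorting the rest by `g`. -/
def removeTerm (m : M) (b : Fin (n + 1) → B) {α : Type*} [LinearOrder α] (r : Fin (n + 1))
    (g : Fin n → α) : HC k B M n :=
  (Equiv.Perm.sign (Tuple.sort g) : ℤ) • (-1 : ℤ) ^ (r : ℕ) • (φ (b r) m ⊗ₜ[k]
    PiTensorProduct.tprod k ((b ∘ r.succAbove) ∘ ⇑(Tuple.sort g)⁻¹))

/-- A labelling is a label `v` at `p` together with `g` on the other positions. Position `p`
receives the entry `r` of `b`, its rank, and the sign of the sort trades `(-1)^p` for `(-1)^r`. The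
term then depends on `p` only through `r`, which allows the two ends to be compared. -/
lemma sum_remove_sort {α : Type*} [LinearOrder α] [Fintype α] (m : M) (b : Fin (n + 1) → B)
    (p : Fin (n + 1)) :
    ∑ f : Fin (n + 1) → α, (Equiv.Perm.sign (Tuple.sort f) : ℤ) • (-1 : ℤ) ^ (p : ℕ) •
        (φ ((b ∘ ⇑(Tuple.sort f)⁻¹) p) m ⊗ₜ[k]
          PiTensorProduct.tprod k ((b ∘ ⇑(Tuple.sort f)⁻¹) ∘ p.succAbove))
      = ∑ v : α, ∑ g : Fin n → α,
        removeTerm φ m b ((Tuple.sort (p.insertNth (α := fun _ => α) v g))⁻¹ p) g := by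
  rw [← Finset.sum_product', Finset.univ_product_univ,
    ← (Fin.insertNthEquiv (fun _ => α) p).sum_comp]
  refine Finset.sum_congr rfl fun vg _ => ?_
  obtain ⟨v, g⟩ := vg
  have hvg : (Fin.insertNthEquiv (fun _ => α) p) (v, g) = p.insertNth (α := fun _ => α) v g := rfl
  rw [hvg]
  set f := p.insertNth (α := fun _ => α) v g with hf
  have hg : f ∘ p.succAbove = g := by
    ext j; simp [hf]
  have he := sort_eq_insertPerm f p
  rw [hg] at he
  set r := (Tuple.sort f)⁻¹ p with hr
  have ht : (b ∘ ⇑(Tuple.sort f)⁻¹) ∘ p.succAbove = (b ∘ r.succAbove) ∘ ⇑(Tuple.sort g)⁻¹ := by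
    ext j
    simp only [Function.comp_apply]
    rw [he, insertPerm_inv_succAbove]
  have hr' : (b ∘ ⇑(Tuple.sort f)⁻¹) p = b r := rfl
  rw [ht, hr', removeTerm, he, sign_insertPerm, smul_smul, smul_smul]
  congr 1
  have h1 : (-1 : ℤ) ^ (p : ℕ) * (-1 : ℤ) ^ (p : ℕ) = 1 := by
    rw [← mul_pow]; simp
  linear_combination ((-1 : ℤ) ^ (r : ℕ) * (Equiv.Perm.sign (Tuple.sort g) : ℤ)) * h1

/-- A first position loses no ties and a last position wins none: label `v + 1` in front is preceded
by the labels `< v + 1`, label `v` at the back by the labels `≤ v`. -/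
lemma sort_insertNth_zero_succ {l : ℕ} (v : Fin l) (g : Fin n → Fin (l + 1)) :
    (Tuple.sort ((0 : Fin (n + 1)).insertNth (α := fun _ => Fin (l + 1)) v.succ g))⁻¹ 0
      = (Tuple.sort ((Fin.last n).insertNth (α := fun _ => Fin (l + 1)) v.castSucc g))⁻¹
        (Fin.last n) := by
  refine Fin.ext ?_
  rw [sort_inv_val_succAbove, sort_inv_val_succAbove]
  congr 1
  ext a
  simp only [Finset.mem_filter, Finset.mem_univ, true_and, Fin.insertNth_apply_succAbove,
    Fin.insertNth_apply_same]
  simp only [Fin.lt_def, Fin.ext_iff, Fin.succAbove_last, Fin.succAbove_zero,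
    Fin.val_succ, Fin.val_castSucc, Fin.val_zero, Fin.val_last]
  omega

lemma sort_insertNth_zero_zero {l : ℕ} (g : Fin n → Fin (l + 1)) :
    (Tuple.sort ((0 : Fin (n + 1)).insertNth (α := fun _ => Fin (l + 1)) 0 g))⁻¹ 0 = 0 := by
  refine Fin.ext ?_
  rw [sort_inv_val_succAbove]
  simp

lemma sort_insertNth_last_last {l : ℕ} (g : Fin n → Fin (l + 1)) :
    (Tuple.sort ((Fin.last n).insertNth (α := fun _ => Fin (l + 1)) (Fin.last l) g))⁻¹
      (Fin.last n) = Fin.last n := by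
  refine Fin.ext ?_
  rw [sort_inv_val_succAbove, Finset.filter_true_of_mem]
  · simp
  · intro a _
    simp only [Fin.insertNth_apply_succAbove, Fin.insertNth_apply_same]
    simp only [Fin.lt_def, Fin.ext_iff,
      Fin.succAbove_last, Fin.val_castSucc, Fin.val_last]
    omega

/-- Inner faces match by `sum_mergeTuple_sort`. The two outer faces act through the same `φ`, so
their sums over the label of the removed position telescope. The survivors, label `0` in front and
label `l` at the back, are the outer faces of the target. -/
lemma hochD_groupAlgebraAction_sortSum_succ (l : ℕ) (z : HC k B M (n + 1)) :
    hochD φ n (groupAlgebraAction k R B M (sortSum k (Fin (l + 1)) (n + 1)) z)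
      = groupAlgebraAction k R B M (sortSum k (Fin (l + 1)) n) (hochD φ n z) := by
  refine LinearMap.congr_fun (f := hochD φ n ∘ₗ groupAlgebraAction k R B M _)
    (g := groupAlgebraAction k R B M _ ∘ₗ hochD φ n) (HC_ext fun m b => ?_) z
  simp only [LinearMap.comp_apply]
  rw [groupAlgebraAction_sortSum, map_sum]
  simp only [map_zsmul, hochD_tmul, map_add, map_sub, map_sum, groupAlgebraAction_sortSum,
    smul_sub, smul_add, Finset.sum_add_distrib, Finset.sum_sub_distrib, Finset.smul_sum]
  have e0 := sum_remove_sort (α := Fin (l + 1)) φ m b 0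
  have e1 := sum_remove_sort (α := Fin (l + 1)) φ m b (Fin.last n)
  simp only [Fin.val_zero, pow_zero, one_smul, Fin.val_last] at e0 e1
  rw [e0, e1]
  have em : ∑ f : Fin (n + 1) → Fin (l + 1), ∑ p : Fin n, (Equiv.Perm.sign (Tuple.sort f) : ℤ) •
      (-1 : ℤ) ^ (p + 1 : ℕ) •
        (m ⊗ₜ[k] PiTensorProduct.tprod k (mergeTuple p (b ∘ ⇑(Tuple.sort f)⁻¹)))
      = ∑ p : Fin n, ∑ g : Fin n → Fin (l + 1), (-1 : ℤ) ^ (p + 1 : ℕ) •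
        (Equiv.Perm.sign (Tuple.sort g) : ℤ) •
        (m ⊗ₜ[k] PiTensorProduct.tprod k (mergeTuple p b ∘ ⇑(Tuple.sort g)⁻¹)) := by
    rw [Finset.sum_comm, Finset.sum_congr rfl fun p _ => sum_mergeTuple_sort m b p,
      Finset.sum_comm, Finset.sum_comm (γ := Fin n)]
    refine Finset.sum_congr rfl fun g _ => ?_
    -- For fixed `g`, the rank of `p` runs over all positions once as `p` does.
    rw [Equiv.sum_comp (Tuple.sort g)⁻¹ fun s => (Equiv.Perm.sign (Tuple.sort g) : ℤ) •
      (-1 : ℤ) ^ (s + 1 : ℕ) •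
      (m ⊗ₜ[k] PiTensorProduct.tprod k (mergeTuple s b ∘ ⇑(Tuple.sort g)⁻¹))]
    exact Finset.sum_congr rfl fun s _ => smul_comm _ _ _
  -- Splitting off opposite ends aligns label `v + 1` in front with label `v` at the back; these
  -- cancel.
  rw [em, Fin.sum_univ_succ, Fin.sum_univ_castSucc (fun v : Fin (l + 1) => _)]
  simp only [sort_insertNth_zero_succ, sort_insertNth_zero_zero, sort_insertNth_last_last]
  have f0 : ∀ g : Fin n → Fin (l + 1), removeTerm φ m b 0 g =
      (Equiv.Perm.sign (Tuple.sort g) : ℤ) • (φ (b 0) m ⊗ₜ[k]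
        PiTensorProduct.tprod k ((b ∘ (0 : Fin (n + 1)).succAbove) ∘ ⇑(Tuple.sort g)⁻¹)) :=
    fun g => by simp [removeTerm]
  have f1 : ∀ g : Fin n → Fin (l + 1), removeTerm φ m b (Fin.last n) g =
      (-1 : ℤ) ^ n • (Equiv.Perm.sign (Tuple.sort g) : ℤ) • (φ (b (Fin.last n)) m ⊗ₜ[k]
        PiTensorProduct.tprod k ((b ∘ (Fin.last n).succAbove) ∘ ⇑(Tuple.sort g)⁻¹)) :=
    fun g => by rw [removeTerm, smul_comm, Fin.val_last]
  simp only [f0, f1]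
  abel

/-- The two faces out of degree 1 agree because `M` is symmetric. This keeps the degree 0
conventions harmless. -/
lemma hochD_zero (z : HC k B M 1) : hochD φ 0 z = 0 := by
  refine LinearMap.congr_fun (g := 0) (HC_ext fun m b => ?_) z
  have h : b ∘ (Fin.last 0).succAbove = b ∘ (0 : Fin 1).succAbove := by
    ext j; exact j.elim0
  rw [hochD_tmul, h]
  simp

/-- Interpolation also uses `l = 0`. There is no labelling by the empty set in positive degree, but
one in degree 0, hence the restriction on the degrees. -/
lemma hochD_groupAlgebraAction_sortSum (l : ℕ) (z : HC k B M (n + 2)) :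
    hochD φ (n + 1) (groupAlgebraAction k R B M (sortSum k (Fin l) (n + 2)) z)
      = groupAlgebraAction k R B M (sortSum k (Fin l) (n + 1)) (hochD φ (n + 1) z) := by
  cases l with
  | zero =>
    have h : ∀ n, sortSum k (Fin 0) (n + 1) = 0 := fun n => by simp [sortSum]
    rw [h, h, groupAlgebraAction_zero, groupAlgebraAction_zero]
    simp
  | succ l => exact hochD_groupAlgebraAction_sortSum_succ φ l z

lemma hochD_eulerian [Algebra ℚ k] (n : ℕ) (z : HC k B M (n + 1)) :
    hochD φ n (groupAlgebraAction k R B M (eulerianElement k (n + 1) 1) z)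
      = groupAlgebraAction k R B M (eulerianElement k n 1) (hochD φ n z) := by
  cases n with
  | zero => rw [hochD_zero, hochD_zero, map_zero]
  | succ n =>
    obtain ⟨c, hc⟩ := exists_eulerianElement_eq k (n + 2)
    -- The bound `n + 2` covers both degrees, so the same weights occur on both sides.
    rw [hc (n + 1) le_rfl, hc n (by omega)]
    simp only [groupAlgebraAction_sum, LinearMap.sum_apply, map_sum, groupAlgebraAction_smul]
    refine Finset.sum_congr rfl fun m _ => ?_
    rw [← hochD_groupAlgebraAction_sortSum, ← algebraMap_smul R (c m), ← algebraMap_smul R (c m),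
      map_smul]

lemma hochD_totalShuffle (n : ℕ) (z : HC k B M (n + 1)) :
    hochD φ n (groupAlgebraAction k R B M (totalShuffle k (n + 1)) z)
      = groupAlgebraAction k R B M (totalShuffle k n) (hochD φ n z) := by
  cases n with
  | zero => rw [hochD_zero, hochD_zero, map_zero]
  | succ n =>
    have h : ∀ (n : ℕ) (z : HC k B M (n + 1)),
        groupAlgebraAction k R B M (totalShuffle k (n + 1)) z
          = groupAlgebraAction k R B M (sortSum k (Fin 2) (n + 1)) z - (2 : ℤ) • z := fun n z => by
      have h2 : sortSum k (Fin 2) (n + 1) = totalShuffle k (n + 1) + (1 + 1) := by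
        rw [totalShuffle_eq, one_add_one_eq_two, sub_add_cancel]
      rw [h2, groupAlgebraAction_add, groupAlgebraAction_add, groupAlgebraAction_one]
      simp [two_smul]
    rw [h, h, map_sub, hochD_groupAlgebraAction_sortSum, map_zsmul]

end SortBoundary

/-! ### Degenerate chains -/

section Degenerate

variable {k : Type u} [CommRing k]
variable {R : Type x} [CommRing R] [Algebra k R]
variable {A : Type v} [CommRing A] [Algebra k A]
variable {M : Type w} [AddCommGroup M] [Module k M] [Module R M] [IsScalarTower k R M]
variable (φ : A →ₙₐ[k] Module.End R M) {n : ℕ}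

variable (k R A M) in
/-- The degeneracy inserting `1` at position `j`. -/
def degen (j : Fin (n + 1)) : HC k A M n →ₗ[R] HC k A M (n + 1) :=
  TensorProduct.AlgebraTensorModule.lTensor R M
    (PiTensorProduct.lift ((PiTensorProduct.tprod k (s := fun _ : Fin (n + 1) => A)).curryMid j 1))

lemma degen_tmul (j : Fin (n + 1)) (m : M) (b : Fin n → A) :
    degen k R A M j (m ⊗ₜ[k] PiTensorProduct.tprod k b)
      = m ⊗ₜ[k] PiTensorProduct.tprod k (j.insertNth (α := fun _ => A) 1 b) := by
  rw [degen, TensorProduct.AlgebraTensorModule.lTensor_tmul, PiTensorProduct.lift.tprod]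
  rfl

lemma insertNth_apply_eq_ite {α : Type*} (j : Fin (n + 1)) (y : α) (g : ℕ → α) (a : Fin (n + 1)) :
    j.insertNth (α := fun _ => α) y (fun a => g a.val) a
      = if a.val < j.val then g a else if a.val = j.val then y else g (a.val - 1) := by
  rcases Fin.eq_self_or_eq_succAbove j a with rfl | ⟨a, rfl⟩
  · simp
  · rw [Fin.insertNth_apply_succAbove]
    rcases lt_or_ge a.castSucc j with h | h
    · have h' : a.val < j.val := h
      rw [Fin.succAbove_of_castSucc_lt _ _ h, Fin.val_castSucc, if_pos h']
    · have h' : j.val ≤ a.val := h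
      rw [Fin.succAbove_of_le_castSucc _ _ h, Fin.val_succ, if_neg (by omega), if_neg (by omega),
        Nat.add_sub_cancel]

/-- Extending tuples to sequences on `ℕ` reduces the simplicial identities to case distinctions
without `Fin` casts. -/
lemma exists_eq_comp_val (b : Fin n → A) : ∃ g : ℕ → A, b = fun a => g a.val :=
  ⟨fun a => if h : a < n then b ⟨a, h⟩ else 0, by ext a; simp⟩

lemma degen_degen (i j : Fin (n + 1)) (h : i.val ≤ j.val) (z : HC k A M n) :
    degen k R A M j.succ (degen k R A M i z)
      = degen k R A M i.castSucc (degen k R A M j z) := by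
  refine LinearMap.congr_fun (f := degen k R A M j.succ ∘ₗ degen k R A M i)
    (g := degen k R A M i.castSucc ∘ₗ degen k R A M j) (HC_ext fun m b => ?_) z
  simp only [LinearMap.comp_apply, degen_tmul]
  congr 2
  obtain ⟨g, rfl⟩ := exists_eq_comp_val b
  have e1 := funext (insertNth_apply_eq_ite i (1 : A) g)
  have e2 := funext (insertNth_apply_eq_ite j (1 : A) g)
  ext a
  rw [e1, e2, insertNth_apply_eq_ite j.succ 1
      (fun a => if a < i.val then g a else if a = i.val then 1 else g (a - 1)),
    insertNth_apply_eq_ite i.castSucc 1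
      (fun a => if a < j.val then g a else if a = j.val then 1 else g (a - 1))]
  simp only [Fin.val_succ, Fin.val_castSucc]
  split_ifs <;> first | omega | rfl

/-- Insertion of `1` at position `j` in a sequence. -/
def insertOne (j : ℕ) (g : ℕ → A) (a : ℕ) : A :=
  if a < j then g a else if a = j then 1 else g (a - 1)

/-- The face operation on sequences. -/
def faceSeq (i : ℕ) (g : ℕ → A) (a : ℕ) : A :=
  if a + 1 < i then g a else if a + 1 = i then g a * g (a + 1) else g (a + 1)

lemma insertNth_one_eq (j : Fin (n + 1)) (g : ℕ → A) :
    j.insertNth (α := fun _ => A) 1 (fun a => g a.val) = fun a => insertOne j.val g a.val :=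
  funext (insertNth_apply_eq_ite j (1 : A) g)

lemma faceTuple_eq (i : Fin (n + 2)) (g : ℕ → A) :
    faceTuple i (fun a : Fin (n + 1) => g a.val) = fun a => faceSeq i.val g a.val := rfl

lemma faceCoeff_eq (i : Fin (n + 2)) (g : ℕ → A) :
    faceCoeff φ i (fun a : Fin (n + 1) => g a.val)
      = if i.val = 0 then φ (g 0) else if i.val = n + 1 then φ (g n) else 1 := by
  simp only [faceCoeff, Fin.ext_iff, Fin.val_zero, Fin.val_last]

lemma faceSeq_insertOne_of_le {i j : ℕ} (h : i ≤ j) (g : ℕ → A) :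
    faceSeq i (insertOne (j + 1) g) = insertOne j (faceSeq i g) := by
  ext a
  rcases a with _ | a <;> simp only [faceSeq, insertOne, Nat.add_sub_cancel] <;>
    split_ifs <;> first | omega | rfl

lemma faceSeq_insertOne_of_lt {i j : ℕ} (h : j < i) (g : ℕ → A) :
    faceSeq (i + 1) (insertOne j g) = insertOne j (faceSeq i g) := by
  ext a
  rcases a with _ | a <;> simp only [faceSeq, insertOne, Nat.add_sub_cancel] <;>
    split_ifs <;> first | omega | rfl

lemma faceSeq_insertOne_self (j : ℕ) (g : ℕ → A) : faceSeq j (insertOne j g) = g := by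
  ext a
  simp only [faceSeq, insertOne, Nat.add_sub_cancel]
  split_ifs <;> first | omega | rfl | simp

lemma faceSeq_insertOne_succ (j : ℕ) (g : ℕ → A) : faceSeq (j + 1) (insertOne j g) = g := by
  ext a
  simp only [faceSeq, insertOne, Nat.add_sub_cancel]
  split_ifs <;> first | omega | rfl | simp

lemma face_castSucc_degen_succ (i : Fin (n + 2)) (j : Fin (n + 1)) (h : i.val ≤ j.val)
    (z : HC k A M (n + 1)) :
    face φ i.castSucc (degen k R A M j.succ z) = degen k R A M j (face φ i z) := by
  refine LinearMap.congr_fun (f := face φ i.castSucc ∘ₗ degen k R A M j.succ)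
    (g := degen k R A M j ∘ₗ face φ i) (HC_ext fun m b => ?_) z
  simp only [LinearMap.comp_apply, degen_tmul, face_tmul]
  obtain ⟨g, rfl⟩ := exists_eq_comp_val b
  rw [insertNth_one_eq, faceTuple_eq, faceTuple_eq, insertNth_one_eq, faceCoeff_eq, faceCoeff_eq]
  simp only [Fin.val_castSucc, Fin.val_succ, faceSeq_insertOne_of_le h]
  congr 2
  have hj := j.isLt
  by_cases h0 : i.val = 0
  · simp [h0, insertOne]
  · by_cases h1 : i.val = n + 1
    · omega
    · have h2 : i.val ≠ n + 1 + 1 := by omega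
      simp [h0, h1, h2]

lemma face_succ_degen_castSucc (i : Fin (n + 2)) (j : Fin (n + 1)) (h : j.val < i.val)
    (z : HC k A M (n + 1)) :
    face φ i.succ (degen k R A M j.castSucc z) = degen k R A M j (face φ i z) := by
  refine LinearMap.congr_fun (f := face φ i.succ ∘ₗ degen k R A M j.castSucc)
    (g := degen k R A M j ∘ₗ face φ i) (HC_ext fun m b => ?_) z
  simp only [LinearMap.comp_apply, degen_tmul, face_tmul]
  obtain ⟨g, rfl⟩ := exists_eq_comp_val b
  rw [insertNth_one_eq, faceTuple_eq, faceTuple_eq, insertNth_one_eq, faceCoeff_eq, faceCoeff_eq]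
  simp only [Fin.val_castSucc, Fin.val_succ, faceSeq_insertOne_of_lt h]
  congr 2
  have hj := j.isLt
  have h0 : i.val ≠ 0 := by omega
  by_cases h1 : i.val = n + 1
  · have h3 : ¬ n + 1 < j.val := by omega
    have h4 : n + 1 ≠ j.val := by omega
    simp [h1, insertOne, h3, h4]
  · simp [h0, h1]

lemma face_castSucc_degen (hφ : φ 1 = 1) (j : Fin (n + 1)) (z : HC k A M n) :
    face φ j.castSucc (degen k R A M j z) = z := by
  refine LinearMap.congr_fun (f := face φ j.castSucc ∘ₗ degen k R A M j)
    (g := LinearMap.id) (HC_ext fun m b => ?_) z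
  simp only [LinearMap.comp_apply, degen_tmul, face_tmul, LinearMap.id_apply]
  obtain ⟨g, rfl⟩ := exists_eq_comp_val b
  rw [insertNth_one_eq, faceTuple_eq, faceCoeff_eq]
  simp only [Fin.val_castSucc, faceSeq_insertOne_self]
  congr 2
  have hj := j.isLt
  have h1 : j.val ≠ n + 1 := by omega
  by_cases h0 : j.val = 0
  · simp [h0, insertOne, hφ]
  · simp [h0, h1]

lemma face_succ_degen (hφ : φ 1 = 1) (j : Fin (n + 1)) (z : HC k A M n) :
    face φ j.succ (degen k R A M j z) = z := by
  refine LinearMap.congr_fun (f := face φ j.succ ∘ₗ degen k R A M j)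
    (g := LinearMap.id) (HC_ext fun m b => ?_) z
  simp only [LinearMap.comp_apply, degen_tmul, face_tmul, LinearMap.id_apply]
  obtain ⟨g, rfl⟩ := exists_eq_comp_val b
  rw [insertNth_one_eq, faceTuple_eq, faceCoeff_eq]
  simp only [Fin.val_succ, faceSeq_insertOne_succ]
  congr 2
  by_cases h1 : j.val = n
  · simp [h1, insertOne, hφ]
  · simp [h1]

variable (k R A M) in
/-- The chains generated by the images of the degeneracies inserting `1` at a position `< j`. -/
def degenerate (j : ℕ) : ∀ n, Submodule R (HC k A M n)
  | 0 => ⊥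
  | n + 1 => ⨆ i : Fin (n + 1), ⨆ _ : i.val < j, LinearMap.range (degen k R A M (n := n) i)

lemma degen_mem_degenerate {j : ℕ} (i : Fin (n + 1)) (h : i.val < j) (z : HC k A M n) :
    degen k R A M i z ∈ degenerate k R A M j (n + 1) :=
  Submodule.mem_iSup_of_mem i (Submodule.mem_iSup_of_mem h ⟨z, rfl⟩)

lemma degenerate_induction {j : ℕ} {P : Submodule R (HC k A M (n + 1))}
    (h : ∀ i : Fin (n + 1), i.val < j → ∀ z, degen k R A M i z ∈ P) :
    degenerate k R A M j (n + 1) ≤ P := by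
  refine iSup_le fun i => iSup_le fun hi => ?_
  rintro _ ⟨z, rfl⟩
  exact h i hi z

lemma degenerate_mono {j l : ℕ} (h : j ≤ l) : degenerate k R A M j n ≤ degenerate k R A M l n := by
  cases n with
  | zero => exact le_rfl
  | succ n => exact degenerate_induction fun i hi z => degen_mem_degenerate i (by omega) z

lemma degen_mem_degenerate_of_mem (j : Fin (n + 1)) (z : HC k A M n)
    (hz : z ∈ degenerate k R A M j n) :
    degen k R A M j z ∈ degenerate k R A M j (n + 1) := by
  cases n with
  | zero =>
    have : z = 0 := hz
    rw [this, map_zero]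
    exact Submodule.zero_mem _
  | succ n =>
    rcases Fin.eq_zero_or_eq_succ j with rfl | ⟨j, rfl⟩
    · have : z ∈ (⊥ : Submodule R _) := degenerate_induction (fun i hi => by simp at hi) hz
      rw [(Submodule.mem_bot R).1 this, map_zero]
      exact Submodule.zero_mem _
    · refine Submodule.mem_comap.1 (degenerate_induction (P := Submodule.comap
        (degen k R A M j.succ) (degenerate k R A M (j.succ : Fin (n + 2)).val (n + 2)))
        (fun i hi z => ?_) hz)
      have hi' : i.val < j.val + 1 := hi
      rw [Submodule.mem_comap, degen_degen i j (by omega)]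
      exact degen_mem_degenerate _ (by simpa using hi') _

/-- The part of the boundary of `degen j z` given by the faces beyond `j + 1`. -/
def upperBoundary (j : Fin (n + 1)) (z : HC k A M n) : HC k A M n :=
  ∑ i : Fin (n + 2), if j.val + 1 < i.val then
    (-1 : ℤ) ^ (i : ℕ) • face φ i (degen k R A M j z) else 0

/-- Faces `j` and `j + 1` undo the degeneracy and cancel; a face below `j` passes through it and
lowers its index by one. -/
lemma hochD_degen_sub_mem (hφ : φ 1 = 1) (j : Fin (n + 1)) (z : HC k A M n) :
    hochD φ n (degen k R A M j z) - upperBoundary φ j z ∈ degenerate k R A M j n := by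
  have hd : hochD φ n (degen k R A M j z) - upperBoundary φ j z
      = ∑ i : Fin (n + 2), ((if i = j.castSucc then (-1 : ℤ) ^ (j : ℕ) • z else 0)
        + (if i = j.succ then -((-1 : ℤ) ^ (j : ℕ) • z) else 0)
        + if i.val < j.val then (-1 : ℤ) ^ (i : ℕ) • face φ i (degen k R A M j z) else 0) := by
    simp only [hochD, upperBoundary, LinearMap.sum_apply, LinearMap.smul_apply]
    rw [← Finset.sum_sub_distrib]
    refine Finset.sum_congr rfl fun i _ => ?_
    rcases lt_trichotomy i.val j.val with h | h | h
    · rw [if_neg (by omega), if_neg (by simp [Fin.ext_iff]; omega),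
        if_neg (by simp [Fin.ext_iff]; omega), if_pos h]
      simp
    · have : i = j.castSucc := Fin.ext h
      subst this
      rw [face_castSucc_degen φ hφ, if_neg (by omega), if_pos rfl,
        if_neg (by simp [Fin.ext_iff]), if_neg (by omega)]
      simp
    · by_cases h' : i.val = j.val + 1
      · have : i = j.succ := Fin.ext h'
        subst this
        rw [face_succ_degen φ hφ, if_neg (by omega), if_neg (by simp [Fin.ext_iff]), if_pos rfl,
          if_neg (by omega), Fin.val_succ, pow_succ]
        simp
      · rw [if_pos (by omega), if_neg (by simp [Fin.ext_iff]; omega),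
          if_neg (by simp [Fin.ext_iff]; omega), if_neg (by omega)]
        simp
  rw [hd, Finset.sum_add_distrib, Finset.sum_add_distrib]
  simp only [Finset.sum_ite_eq', Finset.mem_univ, if_true, add_neg_cancel, zero_add]
  refine Submodule.sum_mem _ fun i _ => ?_
  split_ifs with h
  · refine zsmul_mem ?_ _
    cases n with
    | zero => omega
    | succ n =>
      rcases Fin.eq_zero_or_eq_succ j with rfl | ⟨j, rfl⟩
      · simp at h
      · have h' : i.val < j.val + 1 := h
        have hi : i = (⟨i.val, by omega⟩ : Fin (n + 2)).castSucc := rfl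
        rw [hi, face_castSucc_degen_succ φ _ _ (by simp; omega)]
        exact degen_mem_degenerate j (by simp) _
  · exact Submodule.zero_mem _

lemma upperBoundary_mem (j : Fin (n + 1)) (z : HC k A M n) :
    upperBoundary φ j z ∈ degenerate k R A M (j + 1) n := by
  refine Submodule.sum_mem _ fun i _ => ?_
  split_ifs with h
  · refine zsmul_mem ?_ _
    cases n with
    | zero => omega
    | succ n =>
      obtain ⟨j', rfl⟩ : ∃ j' : Fin (n + 1), j = j'.castSucc := ⟨⟨j.val, by omega⟩, rfl⟩
      obtain ⟨i', rfl⟩ : ∃ i' : Fin (n + 2), i = i'.succ :=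
        ⟨⟨i.val - 1, by omega⟩, Fin.ext (by simp; omega)⟩
      rw [face_succ_degen_castSucc φ _ _ (by simpa using h)]
      exact degen_mem_degenerate _ (by simp) _
  · exact Submodule.zero_mem _

lemma hochD_mem_degenerate (hφ : φ 1 = 1) (j : ℕ) (z : HC k A M (n + 1))
    (hz : z ∈ degenerate k R A M j (n + 1)) : hochD φ n z ∈ degenerate k R A M j n := by
  refine Submodule.mem_comap.1 (degenerate_induction (P := Submodule.comap (hochD φ n)
    (degenerate k R A M j n)) (fun i hi z => ?_) hz)
  rw [Submodule.mem_comap, ← sub_add_cancel (hochD φ n _) (upperBoundary φ i z)]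
  exact Submodule.add_mem _ (degenerate_mono hi.le (hochD_degen_sub_mem φ hφ i z))
    (degenerate_mono hi (upperBoundary_mem φ i z))

/-- Face `j + 2` moves past the outer degeneracy and undoes the inner one, giving the first term.
The later faces move past the outer one with an index shift, hence the minus sign. Thus the doubled
degeneracy acts as a contracting homotopy. -/
lemma upperBoundary_degen (hφ : φ 1 = 1) (j : Fin (n + 1)) (z : HC k A M n) :
    upperBoundary φ j.castSucc (degen k R A M j z)
      = (-1 : ℤ) ^ (j : ℕ) • degen k R A M j z - degen k R A M j (upperBoundary φ j z) := by
  have h1 : ∀ i : Fin (n + 2), (if j.castSucc.val + 1 < i.succ.val then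
      (-1 : ℤ) ^ (i.succ : ℕ) • face φ i.succ (degen k R A M j.castSucc (degen k R A M j z)) else 0)
      = (if i = j.succ then (-1 : ℤ) ^ (j : ℕ) • degen k R A M j z else 0)
        - degen k R A M j (if j.val + 1 < i.val then
          (-1 : ℤ) ^ (i : ℕ) • face φ i (degen k R A M j z) else 0) := fun i => by
    simp only [Fin.val_castSucc, Fin.val_succ]
    by_cases h : j.val < i.val
    · rw [face_succ_degen_castSucc φ i j h, if_pos (by omega), pow_succ]
      by_cases h' : i = j.succ
      · subst h'
        rw [face_succ_degen φ hφ, if_pos rfl, if_neg (by simp), Fin.val_succ, pow_succ]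
        simp
      · have h2 : i.val ≠ j.val + 1 := fun h2 => h' (Fin.ext h2)
        rw [if_neg h', if_pos (by omega), map_zsmul]
        simp
    · rw [if_neg (by omega), if_neg (by rintro rfl; simp at h), if_neg (by omega)]
      simp
  rw [upperBoundary, Fin.sum_univ_succ, if_neg (by simp), zero_add,
    Finset.sum_congr rfl fun i _ => h1 i, Finset.sum_sub_distrib, ← map_sum]
  simp only [Finset.sum_ite_eq', Finset.mem_univ, if_true]
  rfl

/-- Degenerate cycles are boundaries. -/
lemma exists_hochD_eq_of_mem_degenerate (hφ : φ 1 = 1) (j : ℕ) (z : HC k A M (n + 1))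
    (hz : z ∈ degenerate k R A M j (n + 1)) (hd : hochD φ n z = 0) :
    ∃ w, hochD φ (n + 1) w = z := by
  -- Induction on the filtration by degeneracy index: subtracting a boundary pushes the cycle one
  -- stage down.
  induction j generalizing z with
  | zero =>
    have : z ∈ (⊥ : Submodule R _) := degenerate_induction (fun i hi => by simp at hi) hz
    exact ⟨0, by rw [map_zero, (Submodule.mem_bot R).1 this]⟩
  | succ j ih =>
    by_cases hj : j < n + 1
    · lift j to Fin (n + 1) using hj
      have hle : degenerate k R A M (j.val + 1) (n + 1)
          ≤ degenerate k R A M j.val (n + 1) ⊔ LinearMap.range (degen k R A M j) := by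
        refine degenerate_induction fun i hi z => ?_
        by_cases h : i = j
        · subst h
          exact Submodule.mem_sup_right ⟨z, rfl⟩
        · have h' : i.val ≠ j.val := fun h' => h (Fin.ext h')
          exact Submodule.mem_sup_left (degen_mem_degenerate i (by omega) z)
      obtain ⟨d, hdm, _, ⟨y, rfl⟩, rfl⟩ := Submodule.mem_sup.1 (hle hz)
      -- All other contributions to the boundary of `z` lie in stage `j`, and the total is zero.
      have hu : upperBoundary φ j y ∈ degenerate k R A M j n := by
        have e : upperBoundary φ j y = -(hochD φ n (degen k R A M j y) - upperBoundary φ j y)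
            - hochD φ n d := by
          rw [map_add] at hd
          rw [eq_neg_of_add_eq_zero_right hd]
          abel
        rw [e]
        exact Submodule.sub_mem _ (Submodule.neg_mem _ (hochD_degen_sub_mem φ hφ j y))
          (hochD_mem_degenerate φ hφ _ d hdm)
      -- By `upperBoundary_degen` the boundary of `w` is `degen j y` modulo stage `j`; the sign
      -- cancels the one found there.
      set w := (-1 : ℤ) ^ (j : ℕ) • degen k R A M j.castSucc (degen k R A M j y) with hw
      have hm : d + degen k R A M j y - hochD φ (n + 1) w ∈ degenerate k R A M j (n + 1) := by
        have h1 := hochD_degen_sub_mem φ hφ j.castSucc (degen k R A M j y)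
        rw [upperBoundary_degen φ hφ, Fin.val_castSucc] at h1
        have h2 := degen_mem_degenerate_of_mem j _ hu
        have hs : (-1 : ℤ) ^ (j : ℕ) * (-1 : ℤ) ^ (j : ℕ) = 1 := by
          rw [← mul_pow]; simp
        have e : d + degen k R A M j y - hochD φ (n + 1) w = d - (-1 : ℤ) ^ (j : ℕ) •
            ((hochD φ (n + 1) (degen k R A M j.castSucc (degen k R A M j y))
              - ((-1 : ℤ) ^ (j : ℕ) • degen k R A M j y
              - degen k R A M j (upperBoundary φ j y))) - degen k R A M j (upperBoundary φ j y))
            := by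
          rw [hw, map_zsmul]
          simp only [smul_sub, smul_smul, hs, one_smul]
          abel
        rw [e]
        exact Submodule.sub_mem _ hdm (zsmul_mem (Submodule.sub_mem _ h1 h2) _)
      obtain ⟨w', hw'⟩ := ih _ hm (by rw [map_sub, hd, hochD_hochD, sub_zero])
      exact ⟨w + w', by rw [map_add, hw']; abel⟩
    · refine ih z ?_ hd
      refine degenerate_induction (fun i hi z => degen_mem_degenerate i ?_ z) hz
      omega

end Degenerate

/-! ### Comparison of `C_⋆(I, M)` and `C_⋆(A, M)` -/

section Functoriality

variable {k : Type u} [CommRing k]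
variable {R : Type x} [CommRing R] [Algebra k R]
variable {B : Type v} [NonUnitalCommRing B] [Module k B] [IsScalarTower k B B] [SMulCommClass k B B]
variable {B' : Type v} [NonUnitalCommRing B'] [Module k B'] [IsScalarTower k B' B']
  [SMulCommClass k B' B']
variable {M : Type w} [AddCommGroup M] [Module k M] [Module R M] [IsScalarTower k R M] {n : ℕ}

variable (R M) in
/-- The map induced by a linear map of the coefficients. -/
def hcMap (n : ℕ) (f : B →ₗ[k] B') : HC k B M n →ₗ[R] HC k B' M n :=
  TensorProduct.AlgebraTensorModule.lTensor R M (PiTensorProduct.map fun _ => f)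

lemma hcMap_tmul (f : B →ₗ[k] B') (m : M) (b : Fin n → B) :
    hcMap R M n f (m ⊗ₜ[k] PiTensorProduct.tprod k b)
      = m ⊗ₜ[k] PiTensorProduct.tprod k (f ∘ b) := by
  rw [hcMap, TensorProduct.AlgebraTensorModule.lTensor_tmul, PiTensorProduct.map_tprod]
  rfl

lemma hcMap_groupAlgebraAction (f : B →ₗ[k] B') (x : MonoidAlgebra k (Equiv.Perm (Fin n)))
    (z : HC k B M n) :
    hcMap R M n f (groupAlgebraAction k R B M x z)
      = groupAlgebraAction k R B' M x (hcMap R M n f z) := by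
  induction x using MonoidAlgebra.induction_linear with
  | zero => simp [groupAlgebraAction_zero]
  | add x y hx hy => simp only [groupAlgebraAction_add, LinearMap.add_apply, map_add, hx, hy]
  | single σ c =>
    refine LinearMap.congr_fun (f := hcMap R M n f ∘ₗ groupAlgebraAction k R B M _)
      (g := groupAlgebraAction k R B' M _ ∘ₗ hcMap R M n f) (HC_ext fun m b => ?_) z
    simp only [LinearMap.comp_apply, groupAlgebraAction_single, hcMap_tmul]
    rw [← algebraMap_smul R c, map_smul, hcMap_tmul, algebraMap_smul]
    rfl

lemma hcMap_hochD (f : B →ₙₐ[k] B') (φ : B →ₙₐ[k] Module.End R M) (φ' : B' →ₙₐ[k] Module.End R M)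
    (h : φ'.comp f = φ) (z : HC k B M (n + 1)) :
    hcMap R M n (f : B →ₗ[k] B') (hochD φ n z)
      = hochD φ' n (hcMap R M (n + 1) (f : B →ₗ[k] B') z) := by
  refine LinearMap.congr_fun (f := hcMap R M n (f : B →ₗ[k] B') ∘ₗ hochD φ n)
      (g := hochD φ' n ∘ₗ hcMap R M (n + 1) (f : B →ₗ[k] B')) (HC_ext fun m b => ?_) z
  have hm : ∀ p : Fin n, (f : B →ₗ[k] B') ∘ mergeTuple p b
      = mergeTuple p ((f : B →ₗ[k] B') ∘ b) := fun p => by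
    ext j
    simp only [mergeTuple, Function.comp_apply]
    split_ifs <;> simp
  have hφ : ∀ y, φ' (f y) = φ y := fun y => by rw [← h]; rfl
  simp only [LinearMap.comp_apply, hcMap_tmul, hochD_tmul, map_add, map_sub, map_sum, map_zsmul, hm]
  simp only [Function.comp_apply, ← hφ]
  rfl

end Functoriality

/-! ### Projecting chains onto the augmentation ideal -/

section Augmentation

variable {k : Type u} [CommRing k] {A : Type v} [CommRing A] [Algebra k A] (ε : A →ₐ[k] k)

/-- The projection of `A` onto the augmentation ideal. -/
def augmentationProj : A →ₗ[k] augmentationIdeal ε where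
  toFun a := ⟨a - algebraMap k A (ε a), by
    change ε (a - algebraMap k A (ε a)) = 0
    simp⟩
  map_add' a b := Subtype.ext (by
    change a + b - algebraMap k A (ε (a + b)) = (a - algebraMap k A (ε a))
      + (b - algebraMap k A (ε b))
    rw [map_add, map_add]
    ring)
  map_smul' c a := Subtype.ext (by
    change c • a - algebraMap k A (ε (c • a)) = c • (a - algebraMap k A (ε a))
    rw [map_smul, smul_eq_mul, map_mul, smul_sub, Algebra.smul_def, Algebra.smul_def])

lemma coe_augmentationProj (a : A) :
    (augmentationProj ε a : A) = a - algebraMap k A (ε a) := rfl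

lemma augmentationProj_coe (a : augmentationIdeal ε) : augmentationProj ε (a : A) = a := by
  refine Subtype.ext ?_
  have h : ε (a : A) = 0 := a.2
  rw [coe_augmentationProj, h, map_zero, sub_zero]

/-- The projection is not multiplicative; the two correction terms are what telescopes in
`hcMap_proj_hochD`. -/
lemma augmentationProj_mul (a b : A) :
    augmentationProj ε (a * b) = augmentationProj ε a * augmentationProj ε b
      + ε a • augmentationProj ε b + ε b • augmentationProj ε a := by
  refine Subtype.ext ?_
  change a * b - algebraMap k A (ε (a * b)) = (a - algebraMap k A (ε a)) *
    (b - algebraMap k A (ε b)) + ε a • (b - algebraMap k A (ε b))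
      + ε b • (a - algebraMap k A (ε a))
  rw [map_mul, map_mul, Algebra.smul_def, Algebra.smul_def]
  ring

/-- The inclusion of the augmentation ideal. -/
def augmentationIncl : augmentationIdeal ε →ₙₐ[k] A :=
  NonUnitalSubalgebraClass.subtype (augmentationIdeal ε)

variable {R : Type x} [CommRing R] [Algebra k R]
variable {M : Type w} [AddCommGroup M] [Module k M] [Module R M] [IsScalarTower k R M]
variable (φ : A →ₙₐ[k] Module.End R M) {n : ℕ}

lemma hcMap_proj_incl (z : HC k (augmentationIdeal ε) M n) :
    hcMap R M n (augmentationProj ε)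
      (hcMap R M n (augmentationIncl ε : augmentationIdeal ε →ₗ[k] A) z) = z := by
  refine LinearMap.congr_fun (f := hcMap R M n (augmentationProj ε) ∘ₗ hcMap R M n
    (augmentationIncl ε : augmentationIdeal ε →ₗ[k] A)) (g := LinearMap.id)
    (HC_ext fun m b => ?_) z
  simp only [LinearMap.comp_apply, hcMap_tmul, LinearMap.id_apply]
  congr 2
  ext1 j
  exact augmentationProj_coe ε (b j)

/-- Entries are projected one at a time. Each replacement changes the tensor by a scalar multiple of
one with the entry `1`, a degeneracy. -/
lemma sub_hcMap_incl_proj_mem (z : HC k A M n) :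
    z - hcMap R M n (augmentationIncl ε : augmentationIdeal ε →ₗ[k] A)
      (hcMap R M n (augmentationProj ε) z) ∈ degenerate k R A M n n := by
  suffices h : LinearMap.range (LinearMap.id - hcMap R M n
      (augmentationIncl ε : augmentationIdeal ε →ₗ[k] A) ∘ₗ hcMap R M n (augmentationProj ε))
      ≤ degenerate k R A M n n from h ⟨z, rfl⟩
  rw [← (degenerate k R A M n n).ker_mkQ, LinearMap.range_le_ker_iff]
  refine HC_ext fun m b => ?_
  rw [LinearMap.zero_apply, LinearMap.comp_apply, ← LinearMap.mem_ker, Submodule.ker_mkQ]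
  simp only [LinearMap.sub_apply, LinearMap.id_apply, LinearMap.comp_apply, hcMap_tmul]
  have key : ∀ j : ℕ, j ≤ n → m ⊗ₜ[k] PiTensorProduct.tprod k b
      - m ⊗ₜ[k] PiTensorProduct.tprod k
        (fun a : Fin n => if a.val < j then (augmentationProj ε (b a) : A) else b a)
      ∈ degenerate k R A M n n := by
    intro j
    induction j with
    | zero =>
      intro _
      simp
    | succ j ih =>
      intro hj
      cases n with
      | zero => omega
      | succ n =>
        set c : Fin (n + 1) → A :=
          fun a => if a.val < j then (augmentationProj ε (b a) : A) else b a with hc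
        set i : Fin (n + 1) := ⟨j, by omega⟩ with hi
        have e1 : c = Function.update c i ((augmentationProj ε (b i) : A)
            + algebraMap k A (ε (b i))) := by
          rw [coe_augmentationProj, sub_add_cancel, Function.eq_update_iff]
          exact ⟨by simp [hc, hi], fun _ _ => rfl⟩
        have e2 : (fun a : Fin (n + 1) => if a.val < j + 1 then (augmentationProj ε (b a) : A)
            else b a) = Function.update c i (augmentationProj ε (b i) : A) := by
          rw [Function.eq_update_iff]
          refine ⟨by simp [hi], fun a ha => ?_⟩
          have ha' : a.val ≠ j := fun h => ha (Fin.ext h)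
          have : a.val < j + 1 ↔ a.val < j := by omega
          simp only [hc, this]
        have e3 : Function.update c i (1 : A)
            = i.insertNth (α := fun _ => A) 1 (c ∘ i.succAbove) := by
          ext a
          rcases Fin.eq_self_or_eq_succAbove i a with rfl | ⟨a, rfl⟩
          · simp
          · simp [Fin.succAbove_ne]
        have e4 : m ⊗ₜ[k] PiTensorProduct.tprod k c
            - m ⊗ₜ[k] PiTensorProduct.tprod k (Function.update c i (augmentationProj ε (b i) : A))
            = degen k R A M i ((ε (b i) • m) ⊗ₜ[k] PiTensorProduct.tprod k (c ∘ i.succAbove)) := by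
          conv_lhs => rw [e1]
          rw [MultilinearMap.map_update_add, Function.update_idem, TensorProduct.tmul_add,
            add_sub_cancel_left, Algebra.algebraMap_eq_smul_one, MultilinearMap.map_update_smul,
            degen_tmul, e3, TensorProduct.tmul_smul, TensorProduct.smul_tmul']
        rw [e2, ← sub_add_sub_cancel _ (m ⊗ₜ[k] PiTensorProduct.tprod k c), e4]
        exact Submodule.add_mem _ (ih (by omega)) (degen_mem_degenerate i i.isLt _)
  have h := key n le_rfl
  simp only [Fin.is_lt, if_true] at h
  exact h

/-- The projection fails to be multiplicative and fails to respect the action; the two errors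
cancel. The inner face at `p` contributes `T p` and `T (p + 1)`, the outer faces `T 0` and `T n`,
and the alternating sum telescopes. -/
lemma hcMap_proj_hochD (hφ : φ 1 = 1) (z : HC k A M (n + 1)) :
    hcMap R M n (augmentationProj ε) (hochD φ n z)
      = hochD (φ.comp (augmentationIncl ε)) n (hcMap R M (n + 1) (augmentationProj ε) z) := by
  refine LinearMap.congr_fun (f := hcMap R M n (augmentationProj ε) ∘ₗ hochD φ n)
    (g := hochD (φ.comp (augmentationIncl ε)) n ∘ₗ hcMap R M (n + 1) (augmentationProj ε))
    (HC_ext fun m b => ?_) z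
  simp only [LinearMap.comp_apply, hcMap_tmul, hochD_tmul, map_add, map_sub, map_sum, map_zsmul]
  set π := augmentationProj ε with hπ
  -- The error term in which entry `q` is replaced by its augmentation.
  set T : Fin (n + 1) → HC k (augmentationIdeal ε) M n := fun q =>
    ε (b q) • (m ⊗ₜ[k] PiTensorProduct.tprod k ((π ∘ b) ∘ q.succAbove)) with hT
  have hφπ : ∀ a, φ a m = (φ.comp (augmentationIncl ε)) (π a) m + ε a • m := fun a => by
    have h1 : (φ.comp (augmentationIncl ε)) (π a) = φ (a - ε a • 1) := by
      rw [← Algebra.algebraMap_eq_smul_one]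
      rfl
    rw [h1, map_sub, map_smul, hφ]
    simp
  have hm : ∀ p : Fin n, m ⊗ₜ[k] PiTensorProduct.tprod k (π ∘ mergeTuple p b)
      = m ⊗ₜ[k] PiTensorProduct.tprod k (mergeTuple p (π ∘ b)) + T p.castSucc + T p.succ := by
    intro p
    have h1 : ∀ y : augmentationIdeal ε, ∀ j, Function.update ((π ∘ b) ∘ p.succ.succAbove) p y j
        = if j = p then y else π (b (p.succ.succAbove j)) := fun y j => by
      simp only [Function.update_apply, Function.comp_apply]
    have h2 : π ∘ mergeTuple p b = Function.update ((π ∘ b) ∘ p.succ.succAbove) p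
        (π (b p.castSucc) * π (b p.succ) + ε (b p.castSucc) • π (b p.succ)
          + ε (b p.succ) • π (b p.castSucc)) := by
      ext1 j
      rw [h1, ← augmentationProj_mul, Function.comp_apply, mergeTuple]
      split_ifs <;> rfl
    have h3 : mergeTuple p (π ∘ b) = Function.update ((π ∘ b) ∘ p.succ.succAbove) p
        (π (b p.castSucc) * π (b p.succ)) := by
      ext1 j
      rw [h1, mergeTuple]
      rfl
    have h4 : (π ∘ b) ∘ p.castSucc.succAbove
        = Function.update ((π ∘ b) ∘ p.succ.succAbove) p (π (b p.succ)) := by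
      ext1 j
      rw [h1]
      by_cases h : j = p
      · subst h
        simp
      · rw [if_neg h]
        simp only [Function.comp_apply]
        congr 2
        rcases lt_or_gt_of_ne h with h' | h'
        · rw [Fin.succAbove_castSucc_of_lt _ _ h', Fin.succAbove_succ_of_le _ _ h'.le]
        · rw [Fin.succAbove_castSucc_of_le _ _ h'.le, Fin.succAbove_succ_of_lt _ _ h']
    have h5 : (π ∘ b) ∘ p.succ.succAbove
        = Function.update ((π ∘ b) ∘ p.succ.succAbove) p (π (b p.castSucc)) := by
      ext1 j
      rw [h1]
      by_cases h : j = p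
      · subst h
        simp
      · rw [if_neg h]
        rfl
    rw [h2, h3, MultilinearMap.map_update_add, MultilinearMap.map_update_add,
      MultilinearMap.map_update_smul, MultilinearMap.map_update_smul, ← h4, ← h5]
    simp only [TensorProduct.tmul_add, TensorProduct.tmul_smul, hT]
  have htel : T 0 + ∑ p : Fin n, (-1 : ℤ) ^ (p + 1 : ℕ) • T p.succ
      = ∑ p : Fin n, (-1 : ℤ) ^ (p : ℕ) • T p.castSucc + (-1 : ℤ) ^ n • T (Fin.last n) := by
    have h1 := Fin.sum_univ_succ fun q : Fin (n + 1) => (-1 : ℤ) ^ (q : ℕ) • T q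
    have h2 := Fin.sum_univ_castSucc fun q : Fin (n + 1) => (-1 : ℤ) ^ (q : ℕ) • T q
    simp only [Fin.val_zero, pow_zero, one_smul, Fin.val_succ, Fin.val_castSucc,
      Fin.val_last] at h1 h2
    rw [← h1, h2]
  have hneg : ∑ p : Fin n, (-1 : ℤ) ^ (p + 1 : ℕ) • T p.castSucc
      = -∑ p : Fin n, (-1 : ℤ) ^ (p : ℕ) • T p.castSucc := by
    rw [← Finset.sum_neg_distrib]
    exact Finset.sum_congr rfl fun p _ => by rw [pow_succ]; simp
  simp only [hm, smul_add, Finset.sum_add_distrib, hφπ (b 0), hφπ (b (Fin.last n)),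
    TensorProduct.add_tmul, ← TensorProduct.smul_tmul', hneg]
  have h0 : ε (b 0) • (m ⊗ₜ[k] PiTensorProduct.tprod k (π ∘ b ∘ (0 : Fin (n + 1)).succAbove))
      = T 0 := rfl
  have hl : ε (b (Fin.last n)) • (m ⊗ₜ[k]
      PiTensorProduct.tprod k (π ∘ b ∘ (Fin.last n).succAbove)) = T (Fin.last n) := rfl
  rw [h0, hl, eq_sub_of_add_eq htel]
  simp only [Function.comp_assoc, Function.comp_apply]
  abel

/-- A cycle of `C_⋆(A, M)` is homologous to its projection to `C_⋆(I, M)`. -/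
lemma exists_hochD_eq_sub_incl_proj (hφ : φ 1 = 1) (z : HC k A M (n + 1))
    (hz : hochD φ n z = 0) :
    ∃ w, hochD φ (n + 1) w = z - hcMap R M (n + 1)
      (augmentationIncl ε : augmentationIdeal ε →ₗ[k] A)
      (hcMap R M (n + 1) (augmentationProj ε) z) := by
  refine exists_hochD_eq_of_mem_degenerate φ hφ _ _ (sub_hcMap_incl_proj_mem ε z) ?_
  rw [map_sub, hz, ← hcMap_hochD (augmentationIncl ε) (φ.comp (augmentationIncl ε)) φ rfl,
    ← hcMap_proj_hochD ε φ hφ, hz, map_zero, map_zero, sub_zero]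

end Augmentation

/-! ### Comparison of the Harrison complex and the Eulerian summand of `C_⋆(A, M)` -/

section Comparison

variable (k : Type u) [CommRing k] (A : Type v) [CommRing A] [Algebra k A]
variable (M : Type w) [AddCommGroup M] [Module k M] [Module A M] [IsScalarTower k A M]

/-- The action of `A` on an `A`-module. -/
def moduleAction : A →ₙₐ[k] Module.End k M :=
  (Algebra.lsmul k k M : A →ₐ[k] Module.End k M)

lemma moduleAction_one : moduleAction k A M 1 = 1 :=
  map_one (Algebra.lsmul k k M : A →ₐ[k] Module.End k M)

/-- The identification `M ⊗_A C_n(A, A) = C_n(A, M)`. -/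
def baseChangeHC (n : ℕ) : M ⊗[A] HC k A A n ≃ₗ[k] HC k A M n :=
  (TensorProduct.AlgebraTensorModule.cancelBaseChange k A A M (⨂[k] _ : Fin n, A)).restrictScalars k

variable {k A M} {n : ℕ}

lemma baseChangeHC_tmul (m : M) (a : A) (t : ⨂[k] _ : Fin n, A) :
    baseChangeHC k A M n (m ⊗ₜ[A] (a ⊗ₜ[k] t)) = (a • m) ⊗ₜ[k] t := rfl

lemma baseChangeHC_lTensor {l : ℕ} (f : HC k A A n →ₗ[A] HC k A A l)
    (g : HC k A M n →ₗ[k] HC k A M l)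
    (h : ∀ (m : M) (a : A) (b : Fin n → A), baseChangeHC k A M l
      (m ⊗ₜ[A] f (a ⊗ₜ[k] PiTensorProduct.tprod k b)) = g ((a • m) ⊗ₜ[k] PiTensorProduct.tprod k b))
    (z : M ⊗[A] HC k A A n) :
    baseChangeHC k A M l (f.lTensor M z) = g (baseChangeHC k A M n z) := by
  induction z using TensorProduct.induction_on with
  | zero => simp
  | add x y hx hy => simp only [map_add, hx, hy]
  | tmul m y =>
    rw [LinearMap.lTensor_tmul]
    induction y using TensorProduct.induction_on with
    | zero => simp
    | add x y hx hy => simp only [map_add, TensorProduct.tmul_add, hx, hy]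
    | tmul a t =>
      induction t using PiTensorProduct.induction_on with
      | add x y hx hy => simp only [map_add, TensorProduct.tmul_add, hx, hy]
      | smul_tprod r b =>
        rw [TensorProduct.tmul_smul, TensorProduct.smul_tmul', h, baseChangeHC_tmul]

lemma baseChangeHC_groupAlgebraAction (x : MonoidAlgebra k (Equiv.Perm (Fin n)))
    (z : M ⊗[A] HC k A A n) :
    baseChangeHC k A M n ((groupAlgebraAction k A A A x).lTensor M z)
      = groupAlgebraAction k k A M x (baseChangeHC k A M n z) :=
  baseChangeHC_lTensor _ _ (fun _ _ _ => rfl) z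

lemma baseChangeHC_hochD (z : M ⊗[A] HC k A A (n + 1)) :
    baseChangeHC k A M n ((hochD (selfAction k A) n).lTensor M z)
      = hochD (moduleAction k A M) n (baseChangeHC k A M (n + 1) z) := by
  refine baseChangeHC_lTensor _ _ (fun m a b => ?_) z
  have h1 : ∀ y : A, selfAction k A y a • m = moduleAction k A M y (a • m) := fun y => by
    change (y • a) • m = y • a • m
    rw [smul_assoc]
  have h2 : ∀ (c : ℤ) (y : HC k A A n), baseChangeHC k A M n (m ⊗ₜ[A] (c • y))
      = c • baseChangeHC k A M n (m ⊗ₜ[A] y) := fun c y => by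
    rw [← map_zsmul, ← TensorProduct.tmul_smul]
  simp only [hochD_tmul, TensorProduct.tmul_add, TensorProduct.tmul_sub, TensorProduct.tmul_sum,
    map_add, map_sub, map_sum, h2, baseChangeHC_tmul, h1]

variable (k A M) in
/-- The map `C_n(A, M) → M ⊗_A CHarr_n(A)`, `m ⊗ t ↦ m ⊗ [1 ⊗ t]`. -/
def toHarrison (n : ℕ) : HC k A M n →ₗ[k] M ⊗[A] CHarr k A n :=
  ((shuffleSubmodule k A n).mkQ.lTensor M).restrictScalars k ∘ₗ (baseChangeHC k A M n).symm

lemma toHarrison_baseChangeHC (z : M ⊗[A] HC k A A n) :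
    toHarrison k A M n (baseChangeHC k A M n z) = (shuffleSubmodule k A n).mkQ.lTensor M z := by
  simp [toHarrison]

lemma toHarrison_hochD (z : HC k A M (n + 1)) :
    toHarrison k A M n (hochD (moduleAction k A M) n z)
      = (harrD k A n).lTensor M (toHarrison k A M (n + 1) z) := by
  obtain ⟨z, rfl⟩ := (baseChangeHC k A M (n + 1)).surjective z
  rw [← baseChangeHC_hochD, toHarrison_baseChangeHC, toHarrison_baseChangeHC,
    ← LinearMap.comp_apply, ← LinearMap.comp_apply, ← LinearMap.lTensor_comp,
    ← LinearMap.lTensor_comp]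
  rfl

variable [Algebra ℚ k]

lemma shuffleSubmodule_eq (n : ℕ) : shuffleSubmodule k A n
    = LinearMap.range (groupAlgebraAction k A A A (totalShuffle k n)) := by
  refine generated_eq _ _ (fun n z hz => ?_) n
  obtain ⟨y, rfl⟩ := hz
  exact ⟨_, (hochD_totalShuffle _ n y).symm⟩

variable (k A) in
/-- The map induced on `CHarr_n(A)` by the first Eulerian idempotent. -/
def eulerianLift (n : ℕ) : CHarr k A n →ₗ[A] HC k A A n :=
  (shuffleSubmodule k A n).liftQ (groupAlgebraAction k A A A (eulerianElement k n 1)) (by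
    rw [shuffleSubmodule_eq]
    rintro _ ⟨z, rfl⟩
    rw [LinearMap.mem_ker, ← LinearMap.comp_apply, ← groupAlgebraAction_mul,
      eulerianElement_mul_totalShuffle, groupAlgebraAction_zero, LinearMap.zero_apply])

/-- Since 1 - e^{(1)} is a right multiple of sh, e^{(1)} changes a chain only within the shuffle
complex. The quotient map is thus split over `A`, and stays split after tensoring with `M`. -/
lemma mkQ_comp_eulerianLift (n : ℕ) :
    (shuffleSubmodule k A n).mkQ ∘ₗ eulerianLift k A n = LinearMap.id := by
  refine Submodule.linearMap_qext _ (LinearMap.ext fun z => ?_)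
  change (shuffleSubmodule k A n).mkQ (groupAlgebraAction k A A A (eulerianElement k n 1) z)
    = (shuffleSubmodule k A n).mkQ z
  obtain ⟨y, hy⟩ := exists_one_eq_eulerianElement_add k n
  have h := congrArg (fun x => groupAlgebraAction k A A A x z) hy
  simp only [groupAlgebraAction_one, groupAlgebraAction_add, groupAlgebraAction_mul,
    LinearMap.add_apply, LinearMap.id_apply, LinearMap.comp_apply] at h
  conv_rhs => rw [h]
  rw [map_add, left_eq_add, Submodule.mkQ_apply, Submodule.Quotient.mk_eq_zero, shuffleSubmodule_eq]
  exact ⟨_, rfl⟩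

variable (k A M) in
/-- The map `M ⊗_A CHarr_n(A) → C_n(A, M)` induced by the first Eulerian idempotent. -/
def ofHarrison (n : ℕ) : M ⊗[A] CHarr k A n →ₗ[k] HC k A M n :=
  (baseChangeHC k A M n).toLinearMap ∘ₗ ((eulerianLift k A n).lTensor M).restrictScalars k

lemma toHarrison_ofHarrison (z : M ⊗[A] CHarr k A n) :
    toHarrison k A M n (ofHarrison k A M n z) = z := by
  change toHarrison k A M n (baseChangeHC k A M n ((eulerianLift k A n).lTensor M z)) = z
  rw [toHarrison_baseChangeHC, ← LinearMap.comp_apply, ← LinearMap.lTensor_comp,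
    mkQ_comp_eulerianLift, LinearMap.lTensor_id, LinearMap.id_apply]

lemma ofHarrison_toHarrison (z : HC k A M n) :
    ofHarrison k A M n (toHarrison k A M n z)
      = groupAlgebraAction k k A M (eulerianElement k n 1) z := by
  obtain ⟨z, rfl⟩ := (baseChangeHC k A M n).surjective z
  rw [toHarrison_baseChangeHC, ← baseChangeHC_groupAlgebraAction]
  change baseChangeHC k A M n ((eulerianLift k A n).lTensor M
    ((shuffleSubmodule k A n).mkQ.lTensor M z)) = _
  rw [← LinearMap.comp_apply, ← LinearMap.lTensor_comp]
  rfl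

lemma groupAlgebraAction_ofHarrison (z : M ⊗[A] CHarr k A n) :
    groupAlgebraAction k k A M (eulerianElement k n 1) (ofHarrison k A M n z)
      = ofHarrison k A M n z := by
  rw [← ofHarrison_toHarrison, toHarrison_ofHarrison]

/-- Every Harrison chain comes from `C_⋆(A, M)`, where `ofHarrison` after `toHarrison` is e^{(1)},
which commutes with the boundary. -/
lemma hochD_ofHarrison (z : M ⊗[A] CHarr k A (n + 1)) :
    hochD (moduleAction k A M) n (ofHarrison k A M (n + 1) z)
      = ofHarrison k A M n ((harrD k A n).lTensor M z) := by
  conv_rhs => rw [← toHarrison_ofHarrison z, ← toHarrison_hochD, ofHarrison_toHarrison,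
    ← hochD_eulerian, groupAlgebraAction_ofHarrison]

end Comparison

/-! ### The isomorphism on homology -/

section Main

variable {k : Type u} [CommRing k] [Algebra ℚ k]

lemma generated_eulerian {R : Type x} [CommRing R] [Algebra k R]
    {B : Type v} [NonUnitalCommRing B] [Module k B] [IsScalarTower k B B] [SMulCommClass k B B]
    {M : Type w} [AddCommGroup M] [Module k M] [Module R M] [IsScalarTower k R M]
    (φ : B →ₙₐ[k] Module.End R M) (n : ℕ) :
    generated φ (fun n => LinearMap.range (groupAlgebraAction k R B M (eulerianElement k n 1))) n
      = LinearMap.range (groupAlgebraAction k R B M (eulerianElement k n 1)) := by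
  refine generated_eq φ _ (fun n z hz => ?_) n
  obtain ⟨y, rfl⟩ := hz
  exact ⟨_, (hochD_eulerian φ n y).symm⟩

lemma eulerian_apply_of_mem {R : Type x} [CommRing R] [Algebra k R]
    {B : Type v} [NonUnitalCommRing B] [Module k B] [IsScalarTower k B B] [SMulCommClass k B B]
    {M : Type w} [AddCommGroup M] [Module k M] [Module R M] [IsScalarTower k R M]
    {n : ℕ} {z : HC k B M n}
    (hz : z ∈ LinearMap.range (groupAlgebraAction k R B M (eulerianElement k n 1))) :
    groupAlgebraAction k R B M (eulerianElement k n 1) z = z := by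
  obtain ⟨y, rfl⟩ := hz
  rw [← LinearMap.comp_apply, ← groupAlgebraAction_mul, eulerianElement_mul_self]

/-- A chain map with a retraction which is surjective up to boundaries induces an isomorphism on
homology. -/
lemma isIso_homologyMap_of_retraction {R : Type x} [CommRing R]
    {C D : ChainComplex (ModuleCat.{v} R) ℕ}
    (f : C ⟶ D) (g : D ⟶ C) (hfg : f ≫ g = 𝟙 C) (n : ℕ)
    (h : ∀ y : D.X n, (∀ j, D.d n j y = 0) →
      ∃ w : D.X (n + 1), D.d (n + 1) n w = y - f.f n (g.f n y)) :
    IsIso (HomologicalComplex.homologyMap f n) := by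
  refine ⟨HomologicalComplex.homologyMap g n, ?_, ?_⟩
  · rw [← HomologicalComplex.homologyMap_comp, hfg, HomologicalComplex.homologyMap_id]
  · rw [← HomologicalComplex.homologyMap_comp, ← HomologicalComplex.homologyMap_id,
      ← cancel_epi (D.homologyπ n), HomologicalComplex.homologyπ_naturality,
      HomologicalComplex.homologyπ_naturality]
    refine ModuleCat.hom_ext (LinearMap.ext fun c => ?_)
    have hinj : Function.Injective (D.iCycles n) := (ModuleCat.mono_iff_injective _).1 inferInstance
    obtain ⟨w, hw⟩ := h (D.iCycles n c) fun j => by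
      rw [← ConcreteCategory.comp_apply, D.iCycles_d]
      rfl
    have hc : HomologicalComplex.cyclesMap (𝟙 D) n c - HomologicalComplex.cyclesMap (g ≫ f) n c
        = D.toCycles (n + 1) n w := by
      apply hinj
      rw [map_sub, ← ConcreteCategory.comp_apply, ← ConcreteCategory.comp_apply,
        ← ConcreteCategory.comp_apply, HomologicalComplex.cyclesMap_i,
        HomologicalComplex.cyclesMap_i, HomologicalComplex.toCycles_i, hw]
      rfl
    have h0 : D.homologyπ n (D.toCycles (n + 1) n w) = 0 := by
      rw [← ConcreteCategory.comp_apply, HomologicalComplex.toCycles_comp_homologyπ]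
      rfl
    rw [← hc, map_sub, sub_eq_zero] at h0
    exact h0.symm

variable {A : Type v} [CommRing A] [Algebra k A] (ε : A →ₐ[k] k)
variable (M : Type w) [AddCommGroup M] [Module k M] [Module A M] [IsScalarTower k A M]

/-- The degree `n` part of the normalized Harrison complex. -/
abbrev normalizedSubmodule (n : ℕ) : Submodule k (HC k (augmentationIdeal ε) M n) :=
  generated (idealAction M ε) (fun n => LinearMap.range
    (groupAlgebraAction k k (augmentationIdeal ε) M (eulerianElement k n 1))) n

/-- The comparison map `e^{(1)} C_n(I, M) → M ⊗_A CHarr_n(A)`. -/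
def normalizedToHarrison (n : ℕ) : normalizedSubmodule ε M n →ₗ[k] M ⊗[A] CHarr k A n :=
  toHarrison k A M n ∘ₗ hcMap k M n (augmentationIncl ε : augmentationIdeal ε →ₗ[k] A) ∘ₗ
    (normalizedSubmodule ε M n).subtype

/-- The retraction `M ⊗_A CHarr_n(A) → e^{(1)} C_n(I, M)`. -/
def harrisonToNormalized (n : ℕ) : M ⊗[A] CHarr k A n →ₗ[k] normalizedSubmodule ε M n :=
  (hcMap k M n (augmentationProj ε) ∘ₗ ofHarrison k A M n).codRestrict _ fun z => by
    rw [normalizedSubmodule, generated_eulerian, LinearMap.comp_apply,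
      ← groupAlgebraAction_ofHarrison, hcMap_groupAlgebraAction]
    exact ⟨_, rfl⟩

lemma coe_harrisonToNormalized (n : ℕ) (z : M ⊗[A] CHarr k A n) :
    (harrisonToNormalized ε M n z : HC k (augmentationIdeal ε) M n)
      = hcMap k M n (augmentationProj ε) (ofHarrison k A M n z) := rfl

lemma harrisonToNormalized_normalizedToHarrison (n : ℕ) (x : normalizedSubmodule ε M n) :
    harrisonToNormalized ε M n (normalizedToHarrison ε M n x) = x := by
  refine Subtype.ext ?_
  have hx := (generated_eulerian (idealAction M ε) n).le x.2
  rw [coe_harrisonToNormalized]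
  change hcMap k M n (augmentationProj ε) (ofHarrison k A M n (toHarrison k A M n
    (hcMap k M n (augmentationIncl ε : augmentationIdeal ε →ₗ[k] A) x.1))) = x.1
  rw [ofHarrison_toHarrison, ← hcMap_groupAlgebraAction, eulerian_apply_of_mem hx,
    hcMap_proj_incl]

lemma harrisonComplex_d (n : ℕ) : (harrisonComplex k A M).d (n + 1) n
    = ModuleCat.ofHom (((harrD k A n).lTensor M).restrictScalars k) :=
  ChainComplex.of_d (fun n => ModuleCat.of k (M ⊗[A] CHarr k A n))
    (fun n => ModuleCat.ofHom (((harrD k A n).lTensor M).restrictScalars k)) n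

lemma normalizedHarrisonComplex_d (n : ℕ) : (normalizedHarrisonComplex M ε).d (n + 1) n
    = ModuleCat.ofHom ((hochD (idealAction M ε) n).restrict
      (hochD_mem_generated (idealAction M ε) _ n)) :=
  ChainComplex.of_d (fun n => ModuleCat.of k (normalizedSubmodule ε M n))
    (fun n => ModuleCat.ofHom ((hochD (idealAction M ε) n).restrict
      (hochD_mem_generated (idealAction M ε) _ n))) n

/-- The chain map `e^{(1)} C_⋆(I, M) → M ⊗_A CHarr_⋆(A)`. -/
def normalizedToHarrisonHom : normalizedHarrisonComplex M ε ⟶ harrisonComplex k A M :=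
  ChainComplex.ofHom (fun n => ModuleCat.ofHom (normalizedToHarrison ε M n))
    fun n => by
      rw [harrisonComplex_d, normalizedHarrisonComplex_d]
      refine ModuleCat.hom_ext (LinearMap.ext fun x => ?_)
      change (harrD k A n).lTensor M (toHarrison k A M (n + 1) (hcMap k M (n + 1)
          (augmentationIncl ε : augmentationIdeal ε →ₗ[k] A) x.1))
        = toHarrison k A M n (hcMap k M n (augmentationIncl ε : augmentationIdeal ε →ₗ[k] A)
          (hochD (idealAction M ε) n x.1))
      rw [hcMap_hochD (augmentationIncl ε) (idealAction M ε) (moduleAction k A M) rfl,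
        toHarrison_hochD]

/-- The chain map `M ⊗_A CHarr_⋆(A) → e^{(1)} C_⋆(I, M)`. -/
def harrisonToNormalizedHom : harrisonComplex k A M ⟶ normalizedHarrisonComplex M ε :=
  ChainComplex.ofHom (fun n => ModuleCat.ofHom (harrisonToNormalized ε M n))
    fun n => by
      rw [harrisonComplex_d, normalizedHarrisonComplex_d]
      refine ModuleCat.hom_ext (LinearMap.ext fun (x : M ⊗[A] CHarr k A (n + 1)) =>
        Subtype.ext ?_)
      change hochD (idealAction M ε) n (hcMap k M (n + 1) (augmentationProj ε)
          (ofHarrison k A M (n + 1) x))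
        = hcMap k M n (augmentationProj ε) (ofHarrison k A M n ((harrD k A n).lTensor M x))
      rw [← hochD_ofHarrison, hcMap_proj_hochD ε _ (moduleAction_one k A M)]
      rfl

/-- A Harrison cycle lifts by `ofHarrison` to a cycle of `C_⋆(A, M)`, which differs from its
projection to `I` by a boundary. The bounding chain need not lie in the e^{(1)} part: `toHarrison`
carries it to the Harrison complex in any case. -/
lemma isIso_homologyMap_normalizedToHarrisonHom (n : ℕ) :
    IsIso (HomologicalComplex.homologyMap (normalizedToHarrisonHom ε M) n) := by
  refine isIso_homologyMap_of_retraction _ (harrisonToNormalizedHom ε M) ?_ n ?_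
  · refine HomologicalComplex.hom_ext _ _ fun n => ModuleCat.hom_ext (LinearMap.ext fun x => ?_)
    exact harrisonToNormalized_normalizedToHarrison ε M n x
  · intro (y : M ⊗[A] CHarr k A n) hy
    change ∃ w : M ⊗[A] CHarr k A (n + 1), (harrisonComplex k A M).d (n + 1) n w
      = y - toHarrison k A M n (hcMap k M n (augmentationIncl ε : augmentationIdeal ε →ₗ[k] A)
        (hcMap k M n (augmentationProj ε) (ofHarrison k A M n y)))
    rw [harrisonComplex_d]
    suffices h : ∃ w, hochD (moduleAction k A M) n w = ofHarrison k A M n y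
        - hcMap k M n (augmentationIncl ε : augmentationIdeal ε →ₗ[k] A)
          (hcMap k M n (augmentationProj ε) (ofHarrison k A M n y)) by
      obtain ⟨w, hw⟩ := h
      refine ⟨toHarrison k A M (n + 1) w, ?_⟩
      change (harrD k A n).lTensor M (toHarrison k A M (n + 1) w) = _
      rw [← toHarrison_hochD, hw, map_sub, toHarrison_ofHarrison]
    cases n with
    | zero =>
      -- There are no degenerate chains in degree 0, so the difference itself vanishes.
      have h := sub_hcMap_incl_proj_mem (R := k) ε (ofHarrison k A M 0 y)
      exact ⟨0, by rw [map_zero]; exact ((Submodule.mem_bot k).1 h).symm⟩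
    | succ n =>
      refine exists_hochD_eq_sub_incl_proj ε _ (moduleAction_one k A M) _ ?_
      have h := hy n
      rw [harrisonComplex_d] at h
      have h' : (harrD k A n).lTensor M y = 0 := h
      rw [hochD_ofHarrison, h', map_zero]

end Main

end NormHarr

end

theorem mainTheorem7 {k : Type*} [CommRing k] [Algebra ℚ k]
    {A : Type*} [CommRing A] [Algebra k A] (ε : A →ₐ[k] k)
    (M : Type*) [AddCommGroup M] [Module k M] [Module A M] [IsScalarTower k A M]
    [Module.Flat k M] (n : ℕ) :
    Nonempty ((NormHarr.normalizedHarrisonComplex M ε).homology n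
      ≃ₗ[k] NormHarr.harrisonHomology k A M n) := by
  have := NormHarr.isIso_homologyMap_normalizedToHarrisonHom ε M n
  exact ⟨(asIso (HomologicalComplex.homologyMap
    (NormHarr.normalizedToHarrisonHom ε M) n)).toLinearEquiv⟩
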